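/- Consider probabilistic programs over variables $x_0,x_1,x_2,\dots$, generated by the grammar $$P ::= v := e \;\mid\; P;P \;\mid\; \{P\}\,[p]\,\{P\} \;\mid\; \mathtt{WHILE}\,(b)\,\{P\},$$ where $v$ is a variable, $e$ is an arithmetical expression built from variables and nonnegative rational constants by $+,-,\cdot$, $p$ is a rational number in $[0,1]$, and $b$ is a Boolean combination of comparisons ($=$, $<$) of arithmetical expressions. Rational constants and probabilities are written as fractions of natural numbers, and programs are coded by natural numbers through a standard Gödel numbering. An input (valuation) is a map $\eta$ from the variables to the nonnegative rationals. An assignment $v := e$ stores $\max\{\llbracket e\rrbracket_\eta,0\}$ in $v$; $\{P_1\}[p]\{P_2\}$ executes $P_1$ with probability $p$ and $P_2$ with probability $1-p$; sequential composition and loops have their usual meaning. The termination probability is $$\Pr_{P,\eta}({\downarrow})=\sum_{k=0}^{\infty}\ \sum_{w\in\{L,R\}^{\le k}}\alpha_k(P,\eta,w),$$ where $\alpha_k(P,\eta,w)$ is the product of the probabilities of the choices $w$ if $P$ started on $\eta$ terminates after exactly $k$ steps when its probabilistic choices are resolved (left or right) by exactly the word $w$, and $0$ otherwise. Let $\mathrm{UAST}$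 be the set of programs $P$ with $\Pr_{P,\eta}({\downarrow})=1$ for every input $\eta$, and let $\mathrm{AST}$ be the set of pairs $(P,\eta)$ with $\Pr_{P,\eta}({\downarrow})=1$, where $\eta$ ranges over the inputs with finitely many nonzero values, presented as finite lists of fractions. A set $A$ is in $\Pi^0_2$ if $A=\{x \mid \forall y_1\,\exists y_2\colon (x,y_1,y_2)\in R\}$ for some decidable relation $R$, and it is $\Pi^0_2$-complete if it is in $\Pi^0_2$ and every set in $\Pi^0_2$ is many-one reducible to it by a total computable function. **Theorem.** $\mathrm{UAST}$ is $\Pi^0_2$-complete. Moreover, universal almost-sure termination is exactly as hard as almost-sure termination on a given input: $\mathrm{UAST}\le_{\mathrm m}\mathrm{AST}$ and $\mathrm{AST}\le_{\mathrm m}\mathrm{UAST}$. -/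

import Mathlib

namespace PGCL

open scoped NNRat NNReal ENNReal

/-! ### Syntax -/

/-- Program variables `x₀, x₁, x₂, …`. -/
abbrev Var : Type := ℕ

/-- A nonnegative rational written as a fraction: `(n, d)` denotes `n / (d + 1)`. -/
abbrev FracLit : Type := ℕ × ℕ

/-- The rational denoted by a fraction literal. -/
def FracLit.value (q : FracLit) : ℚ≥0 := (q.1 : ℚ≥0) / ((q.2 : ℚ≥0) + 1)

/-- A rational probability in `[0, 1]`, written by its odds: the literal denotes
`left / (left + right)`. -/
@[ext] structure ProbLit where
  left : ℕ
  right : ℕ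
  pos : 0 < left + right

/-- The probability denoted by a probability literal. -/
def ProbLit.value (p : ProbLit) : ℚ≥0 := (p.left : ℚ≥0) / ((p.left : ℚ≥0) + (p.right : ℚ≥0))

/-- Fraction literals denote exactly the nonnegative rationals. -/
theorem FracLit.exists_value_eq (q : ℚ≥0) : ∃ l : FracLit, l.value = q := by
  refine ⟨(q.num, q.den - 1), ?_⟩
  have h := q.den_pos
  have e : ((q.den - 1 : ℕ) : ℚ≥0) + 1 = q.den := by
    have : q.den - 1 + 1 = q.den := by omega
    exact_mod_cast this
  rw [FracLit.value, e, NNRat.num_div_den]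

theorem ProbLit.value_le_one (p : ProbLit) : p.value ≤ 1 := by
  unfold ProbLit.value
  apply div_le_one_of_le₀ <;> simp

/-- Probability literals denote exactly the rationals in `[0, 1]`. -/
theorem ProbLit.exists_value_eq (q : ℚ≥0) (hq : q ≤ 1) : ∃ p : ProbLit, p.value = q := by
  have h := q.den_pos
  have hle : q.num ≤ q.den := by
    rw [← NNRat.num_div_den q, div_le_one (by exact_mod_cast h)] at hq
    exact_mod_cast hq
  refine ⟨⟨q.num, q.den - q.num, by omega⟩, ?_⟩
  have e : (q.num : ℚ≥0) + ((q.den - q.num : ℕ) : ℚ≥0) = q.den := by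
    have : q.num + (q.den - q.num) = q.den := by omega
    exact_mod_cast this
  rw [ProbLit.value, e, NNRat.num_div_den]

/-- Arithmetical expressions over the program variables. -/
inductive AExp : Type
  | lit (q : FracLit)
  | var (v : Var)
  | add (e₁ e₂ : AExp)
  | sub (e₁ e₂ : AExp)
  | mul (e₁ e₂ : AExp)

/-- Boolean expressions over arithmetical expressions. -/
inductive BExp : Type
  | eq (e₁ e₂ : AExp)
  | lt (e₁ e₂ : AExp)
  | not (b : BExp)
  | and (b₁ b₂ : BExp)

/-- Probabilistic programs: `v := e`, `P; Q`, `{P} [p] {Q}` and `WHILE (b) {P}`. -/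
inductive Prog : Type
  | assign (v : Var) (e : AExp)
  | seq (P Q : Prog)
  | choice (p : ProbLit) (P Q : Prog)
  | while (b : BExp) (P : Prog)

/-! ### Gödel numbering of the syntax

Each syntactic category is put in an explicit bijection with `ℕ`; through it, computability of
functions on programs is computability on the natural numbers (in the sense of Mathlib's
`Computable`). -/

/-- `Nat.unpair (n + 1)` runs through all pairs except `(0, 0)`. -/
def ProbLit.equivNat : ProbLit ≃ ℕ where
  toFun p := Nat.pair p.left p.right - 1
  invFun n := ⟨(Nat.unpair (n + 1)).1, (Nat.unpair (n + 1)).2, by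
    by_contra h
    have h1 : (Nat.unpair (n + 1)).1 = 0 := by omega
    have h2 : (Nat.unpair (n + 1)).2 = 0 := by omega
    have h3 := Nat.pair_unpair (n + 1)
    rw [h1, h2] at h3
    have h4 : Nat.pair 0 0 = 0 := rfl
    omega⟩
  left_inv p := by
    have h := Nat.add_le_pair p.left p.right
    have hp := p.pos
    have e : Nat.pair p.left p.right - 1 + 1 = Nat.pair p.left p.right := by omega
    ext <;> simp [e]
  right_inv n := by simp

instance : Denumerable ProbLit := Denumerable.mk' ProbLit.equivNat

namespace AExp

/-- Code of an arithmetical expression. -/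
def code : AExp → ℕ
  | lit q => 5 * Nat.pair q.1 q.2
  | var v => 5 * v + 1
  | add e₁ e₂ => 5 * Nat.pair e₁.code e₂.code + 2
  | sub e₁ e₂ => 5 * Nat.pair e₁.code e₂.code + 3
  | mul e₁ e₂ => 5 * Nat.pair e₁.code e₂.code + 4

/-- The arithmetical expression with a given code. -/
def ofCode (n : ℕ) : AExp :=
  have h₁ : (Nat.unpair (n / 5)).1 ≤ n / 5 := Nat.unpair_left_le _
  have h₂ : (Nat.unpair (n / 5)).2 ≤ n / 5 := Nat.unpair_right_le _
  if h : n % 5 = 0 then lit (Nat.unpair (n / 5))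
  else if n % 5 = 1 then var (n / 5)
  else if n % 5 = 2 then add (ofCode (Nat.unpair (n / 5)).1) (ofCode (Nat.unpair (n / 5)).2)
  else if n % 5 = 3 then sub (ofCode (Nat.unpair (n / 5)).1) (ofCode (Nat.unpair (n / 5)).2)
  else mul (ofCode (Nat.unpair (n / 5)).1) (ofCode (Nat.unpair (n / 5)).2)
termination_by n
decreasing_by all_goals omega

theorem ofCode_code (e : AExp) : ofCode e.code = e := by
  induction e with
  | lit q => rw [code, ofCode]; simp
  | var v =>
    have h1 (m : ℕ) : (5 * m + 1) % 5 = 1 := by omega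
    have h2 (m : ℕ) : (5 * m + 1) / 5 = m := by omega
    rw [code, ofCode]; simp [h1, h2]
  | add a b iha ihb =>
    have h1 : (5 * Nat.pair a.code b.code + 2) % 5 = 2 := by omega
    have h2 : (5 * Nat.pair a.code b.code + 2) / 5 = Nat.pair a.code b.code := by omega
    rw [code, ofCode]; simp [h1, h2, iha, ihb]
  | sub a b iha ihb =>
    have h1 : (5 * Nat.pair a.code b.code + 3) % 5 = 3 := by omega
    have h2 : (5 * Nat.pair a.code b.code + 3) / 5 = Nat.pair a.code b.code := by omega
    rw [code, ofCode]; simp [h1, h2, iha, ihb]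
  | mul a b iha ihb =>
    have h1 : (5 * Nat.pair a.code b.code + 4) % 5 = 4 := by omega
    have h2 : (5 * Nat.pair a.code b.code + 4) / 5 = Nat.pair a.code b.code := by omega
    rw [code, ofCode]; simp [h1, h2, iha, ihb]

theorem code_ofCode (n : ℕ) : (ofCode n).code = n := by
  induction n using Nat.strong_induction_on with
  | _ n ih =>
    have hl := Nat.unpair_left_le (n / 5)
    have hr := Nat.unpair_right_le (n / 5)
    rw [ofCode]
    split_ifs with h0 h1 h2 h3
    · simp only [code, Nat.pair_unpair]; omega
    · simp only [code]; omega
    all_goals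
      simp only [code]
      rw [ih _ (by omega), ih _ (by omega), Nat.pair_unpair]
      omega

instance : Denumerable AExp := Denumerable.mk' ⟨code, ofCode, ofCode_code, code_ofCode⟩

end AExp

namespace BExp

/-- Code of a Boolean expression. -/
def code : BExp → ℕ
  | eq e₁ e₂ => 4 * Nat.pair e₁.code e₂.code
  | lt e₁ e₂ => 4 * Nat.pair e₁.code e₂.code + 1
  | not b => 4 * b.code + 2
  | and b₁ b₂ => 4 * Nat.pair b₁.code b₂.code + 3

/-- The Boolean expression with a given code. -/
def ofCode (n : ℕ) : BExp :=
  have h₁ : (Nat.unpair (n / 4)).1 ≤ n / 4 := Nat.unpair_left_le _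
  have h₂ : (Nat.unpair (n / 4)).2 ≤ n / 4 := Nat.unpair_right_le _
  if h : n % 4 = 0 then eq (.ofCode (Nat.unpair (n / 4)).1) (.ofCode (Nat.unpair (n / 4)).2)
  else if n % 4 = 1 then lt (.ofCode (Nat.unpair (n / 4)).1) (.ofCode (Nat.unpair (n / 4)).2)
  else if n % 4 = 2 then not (ofCode (n / 4))
  else and (ofCode (Nat.unpair (n / 4)).1) (ofCode (Nat.unpair (n / 4)).2)
termination_by n
decreasing_by all_goals omega

theorem ofCode_code (b : BExp) : ofCode b.code = b := by
  induction b with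
  | eq a b => rw [code, ofCode]; simp [AExp.ofCode_code]
  | lt a b =>
    have h1 : (4 * Nat.pair a.code b.code + 1) % 4 = 1 := by omega
    have h2 : (4 * Nat.pair a.code b.code + 1) / 4 = Nat.pair a.code b.code := by omega
    rw [code, ofCode]; simp [h1, h2, AExp.ofCode_code]
  | not a iha =>
    have h1 : (4 * a.code + 2) % 4 = 2 := by omega
    have h2 : (4 * a.code + 2) / 4 = a.code := by omega
    rw [code, ofCode]; simp [h1, h2, iha]
  | and a b iha ihb =>
    have h1 : (4 * Nat.pair a.code b.code + 3) % 4 = 3 := by omega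
    have h2 : (4 * Nat.pair a.code b.code + 3) / 4 = Nat.pair a.code b.code := by omega
    rw [code, ofCode]; simp [h1, h2, iha, ihb]

theorem code_ofCode (n : ℕ) : (ofCode n).code = n := by
  induction n using Nat.strong_induction_on with
  | _ n ih =>
    have hl := Nat.unpair_left_le (n / 4)
    have hr := Nat.unpair_right_le (n / 4)
    rw [ofCode]
    split_ifs with h0 h1 h2
    · simp only [code, AExp.code_ofCode, Nat.pair_unpair]; omega
    · simp only [code, AExp.code_ofCode, Nat.pair_unpair]; omega
    · simp only [code]
      rw [ih _ (by omega)]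
      omega
    · simp only [code]
      rw [ih _ (by omega), ih _ (by omega), Nat.pair_unpair]
      omega

instance : Denumerable BExp := Denumerable.mk' ⟨code, ofCode, ofCode_code, code_ofCode⟩

end BExp

namespace Prog

/-- Code of a program. -/
def code : Prog → ℕ
  | assign v e => 4 * Nat.pair v e.code
  | seq P Q => 4 * Nat.pair P.code Q.code + 1
  | choice p P Q => 4 * Nat.pair (ProbLit.equivNat p) (Nat.pair P.code Q.code) + 2
  | .while b P => 4 * Nat.pair b.code P.code + 3

/-- The program with a given code. -/
def ofCode (n : ℕ) : Prog :=
  have h₁ : (Nat.unpair (n / 4)).1 ≤ n / 4 := Nat.unpair_left_le _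
  have h₂ : (Nat.unpair (n / 4)).2 ≤ n / 4 := Nat.unpair_right_le _
  have h₃ : (Nat.unpair (Nat.unpair (n / 4)).2).1 ≤ n / 4 := (Nat.unpair_left_le _).trans h₂
  have h₄ : (Nat.unpair (Nat.unpair (n / 4)).2).2 ≤ n / 4 := (Nat.unpair_right_le _).trans h₂
  if h : n % 4 = 0 then assign (Nat.unpair (n / 4)).1 (.ofCode (Nat.unpair (n / 4)).2)
  else if n % 4 = 1 then seq (ofCode (Nat.unpair (n / 4)).1) (ofCode (Nat.unpair (n / 4)).2)
  else if n % 4 = 2 then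
    choice (ProbLit.equivNat.symm (Nat.unpair (n / 4)).1)
      (ofCode (Nat.unpair (Nat.unpair (n / 4)).2).1)
      (ofCode (Nat.unpair (Nat.unpair (n / 4)).2).2)
  else .while (.ofCode (Nat.unpair (n / 4)).1) (ofCode (Nat.unpair (n / 4)).2)
termination_by n
decreasing_by all_goals omega

theorem ofCode_code (P : Prog) : ofCode P.code = P := by
  induction P with
  | assign v e => rw [code, ofCode]; simp [AExp.ofCode_code]
  | seq P Q ihP ihQ =>
    have h1 : (4 * Nat.pair P.code Q.code + 1) % 4 = 1 := by omega
    have h2 : (4 * Nat.pair P.code Q.code + 1) / 4 = Nat.pair P.code Q.code := by omega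
    rw [code, ofCode]; simp [h1, h2, ihP, ihQ]
  | choice p P Q ihP ihQ =>
    have h1 (m : ℕ) : (4 * m + 2) % 4 = 2 := by omega
    have h2 (m : ℕ) : (4 * m + 2) / 4 = m := by omega
    rw [code, ofCode]; simp [h1, h2, ihP, ihQ]
  | _ b P ihP =>
    have h1 (m : ℕ) : (4 * m + 3) % 4 = 3 := by omega
    have h2 (m : ℕ) : (4 * m + 3) / 4 = m := by omega
    rw [code, ofCode]; simp [h1, h2, ihP, BExp.ofCode_code]

theorem code_ofCode (n : ℕ) : (ofCode n).code = n := by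
  induction n using Nat.strong_induction_on with
  | _ n ih =>
    have hl := Nat.unpair_left_le (n / 4)
    have hr := Nat.unpair_right_le (n / 4)
    have hrl := Nat.unpair_left_le (Nat.unpair (n / 4)).2
    have hrr := Nat.unpair_right_le (Nat.unpair (n / 4)).2
    rw [ofCode]
    split_ifs with h0 h1 h2
    · simp only [code, AExp.code_ofCode, Nat.pair_unpair]; omega
    · simp only [code]
      rw [ih _ (by omega), ih _ (by omega), Nat.pair_unpair]
      omega
    · simp only [code]
      rw [ih _ (by omega), ih _ (by omega), Nat.pair_unpair, Equiv.apply_symm_apply,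
        Nat.pair_unpair]
      omega
    · simp only [code, BExp.code_ofCode]
      rw [ih _ (by omega), Nat.pair_unpair]
      omega

instance : Denumerable Prog := Denumerable.mk' ⟨code, ofCode, ofCode_code, code_ofCode⟩

end Prog

/-! ### Semantics -/

/-- Variable valuations; these are also the program inputs. -/
abbrev Val : Type := Var → ℚ≥0

/-- Evaluation of arithmetical expressions. Intermediate values may be negative. -/
def AExp.eval (η : Val) : AExp → ℚ
  | .lit q => q.value
  | .var v => η v
  | .add e₁ e₂ => e₁.eval η + e₂.eval η
  | .sub e₁ e₂ => e₁.eval η - e₂.eval η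
  | .mul e₁ e₂ => e₁.eval η * e₂.eval η

/-- Evaluation of Boolean expressions. -/
def BExp.eval (η : Val) : BExp → Bool
  | .eq e₁ e₂ => decide (e₁.eval η = e₂.eval η)
  | .lt e₁ e₂ => decide (e₁.eval η < e₂.eval η)
  | .not b => !b.eval η
  | .and b₁ b₂ => b₁.eval η && b₂.eval η

/-- The two outcomes of a probabilistic choice. -/
inductive Dir : Type
  | L
  | R
  deriving DecidableEq

instance : Fintype Dir := ⟨{.L, .R}, fun d => by cases d <;> simp⟩

/-- What remains to be executed: nothing (`↓`), a program, or `c; Q` where `c` is itself such a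
remainder (so that `↓; Q` is available). -/
inductive Ctrl : Type
  | halt
  | run (P : Prog)
  | seq (c : Ctrl) (Q : Prog)

/-- Program states `⟨c, η, a, θ⟩`: remaining program, valuation, probability of the choices made so
far, and the sequence of these choices. -/
structure State where
  ctrl : Ctrl
  val : Val
  prob : ℚ≥0
  hist : List Dir

/-- `nextProg η a θ P b` is the one-step successor of `⟨P, η, a, θ⟩` whose choice sequence is `θ · b`,
where `b = none` stands for the empty word. An assigned value is cut off at `0`
(`Rat.toNNRat q = max q 0`); the difference `1 - p` is exact, as `p ≤ 1`. -/
def nextProg (η : Val) (a : ℚ≥0) (θ : List Dir) : Prog → Option Dir → Option State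
  | .assign v e, none => some ⟨.halt, Function.update η v (e.eval η).toNNRat, a, θ⟩
  | .seq P Q, b => (nextProg η a θ P b).map fun τ => { τ with ctrl := .seq τ.ctrl Q }
  | .choice p P _, some .L => some ⟨.run P, η, a * p.value, θ ++ [.L]⟩
  | .choice p _ Q, some .R => some ⟨.run Q, η, a * (1 - p.value), θ ++ [.R]⟩
  | .while c P, none =>
    if c.eval η then some ⟨.run (.seq P (.while c P)), η, a, θ⟩ else some ⟨.halt, η, a, θ⟩
  | _, _ => none

/-- Extension of `nextProg` to all remainders: `↓; Q` steps to `Q`, and `↓` has no successor. -/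
def nextCtrl (η : Val) (a : ℚ≥0) (θ : List Dir) : Ctrl → Option Dir → Option State
  | .halt, _ => none
  | .run P, b => nextProg η a θ P b
  | .seq .halt Q, none => some ⟨.run Q, η, a, θ⟩
  | .seq .halt _, some _ => none
  | .seq c Q, b => (nextCtrl η a θ c b).map fun τ => { τ with ctrl := .seq τ.ctrl Q }

/-- The one-step successor of a state whose choice sequence is extended by `b`, if there is one. -/
def State.next (σ : State) (b : Option Dir) : Option State :=
  nextCtrl σ.val σ.prob σ.hist σ.ctrl b

/-- The state successor function `T_k(σ, w)`: the state reached from `σ` in exactly `k` steps when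
the probabilistic choices are resolved by exactly the word `w`; `none` stands for `⊥`. -/
def T : ℕ → State → List Dir → Option State
  | 0, σ, [] => some σ
  | 0, _, _ :: _ => none
  | k + 1, σ, w =>
    match σ.next none, w with
    | some τ, w => T k τ w
    | none, [] => none
    | none, b :: w' => (σ.next (some b)).bind fun τ => T k τ w'

/-- The probability stored in a terminal state, and `0` for any other state and for `⊥`. -/
def alpha : Option State → ℚ≥0
  | some ⟨.halt, _, a, _⟩ => a
  | _ => 0

/-- The initial state of `P` on input `η`. -/
def init (P : Prog) (η : Val) : State := ⟨.run P, η, 1, []⟩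

/-- The probability that `P` terminates on input `η`:
`∑_k ∑_{w ∈ {L,R}^{≤ k}} α (T_k (σ_{P,η}, w))`, as a sum in `[0, ∞]`. -/
noncomputable def termProb (P : Prog) (η : Val) : ℝ≥0∞ :=
  ∑' k : ℕ, ∑ i ∈ Finset.range (k + 1), ∑ w : Fin i → Dir,
    (((alpha (T k (init P η) (List.ofFn w)) : ℚ≥0) : ℝ≥0) : ℝ≥0∞)

/-- `P` terminates almost surely on input `η`. -/
def TerminatesAS (P : Prog) (η : Val) : Prop := termProb P η = 1

/-- Finite presentation of an input: the `v`-th entry of the list is the value of the variable `v`,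
and variables beyond the list have the value `0`. -/
def inputOf (l : List FracLit) : Val := fun v => (l.getD v (0, 0)).value

/-- The problem of almost-sure termination on a given (finitely presented) input. -/
def AST (x : Prog × List FracLit) : Prop := TerminatesAS x.1 (inputOf x.2)

/-- The problem of universal almost-sure termination: almost-sure termination on every input. -/
def UAST (P : Prog) : Prop := ∀ η : Val, TerminatesAS P η

/-! ### Arithmetical hierarchy -/

/-- `A` is a `Π⁰₂` set: `A = {x | ∀ y₁, ∃ y₂, (x, y₁, y₂) ∈ R}` for a decidable relation `R`. -/
def IsPi02 {α : Type} [Primcodable α] (A : α → Prop) : Prop :=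
  ∃ R : α × ℕ × ℕ → Prop, ComputablePred R ∧ ∀ x, A x ↔ ∀ y₁, ∃ y₂, R (x, y₁, y₂)

/-- `A` is `Π⁰₂`-complete: it is a `Π⁰₂` set, and every `Π⁰₂` set many-one reduces to it. -/
def IsPi02Complete {α : Type} [Primcodable α] (A : α → Prop) : Prop :=
  IsPi02 A ∧ ∀ (β : Type) [Primcodable β] (C : β → Prop), IsPi02 C → ManyOneReducible C A

end PGCL

namespace PGCL

open scoped NNRat NNReal ENNReal

/-! ### Termination probability by steps -/

/-! Upper bound. Almost-sure termination says that for every `n` some step bound `k` yields halting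
probability at least `n / (n + 1)` (`terminatesAS_iff`). The probability of halting within `k` steps
is a rational number obtained by running all branches breadth-first, and this is primitive recursive
in program, finite input and `k` (`primrec_haltFrac`). Hence `AST` is `Π⁰₂`. A program reads only
finitely many variables, so termination on every input is termination on every finitely presented
input (`UAST_iff`), and the extra universal quantifier over lists is absorbed by the outer one
(`IsPi02.forall`).

Lower bound. By Kleene's normal form a `Π⁰₂` set is `{x | ∀ y, ∃ k, G (y, x, k) = 0}` with `G`
primitive recursive (`IsPi02.exists_primrec`), and `G` is computed by a program without random
choices (`exists_computes`). The reduction sends `x` to a program that draws `y` geometrically and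
then searches for `k`. If every `y` has a witness, only the endless run of coin tosses diverges, an
event of probability `0`; if some `y` has none, the mass `2 ^ (-(y + 1))` of the branch drawing it
is lost. The program overwrites the registers it depends on, so the outcome is the same on all
inputs, and one reduction proves hardness of both `UAST` and `AST`. The two mutual reductions then
follow from membership and hardness.

The bridge is `stackHalt`, a recursion on stacks of programs. Its step counts differ from those of
the given semantics, but its limit is the same (`termProb_eq_stackTerm`). -/

/-- The probability that a run from `σ` halts after exactly `k` steps. -/
def haltAt : ℕ → State → ℚ≥0
  | 0, σ => alpha (some σ)
  | k + 1, σ =>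
    match σ.next none with
    | some τ => haltAt k τ
    | none => (σ.next (some .L)).elim 0 (haltAt k) + (σ.next (some .R)).elim 0 (haltAt k)

theorem T_succ_of_some {σ τ : State} (h : σ.next none = some τ) (k : ℕ) (w : List Dir) :
    T (k + 1) σ w = T k τ w := by
  simp [T, h]

theorem T_succ_nil_of_none {σ : State} (h : σ.next none = none) (k : ℕ) :
    T (k + 1) σ [] = none := by
  simp [T, h]

theorem T_succ_cons_of_none {σ : State} (h : σ.next none = none) (k : ℕ) (b : Dir)
    (w : List Dir) : T (k + 1) σ (b :: w) = (σ.next (some b)).bind fun τ => T k τ w := by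
  simp [T, h]

/-- A step consumes at most one letter, so a word longer than the number of steps is never used up.
-/
theorem alpha_T_of_lt_length : ∀ (k : ℕ) (σ : State) (w : List Dir), k < w.length →
    alpha (T k σ w) = 0
  | 0, σ, [], h => by simp at h
  | 0, σ, b :: w, _ => by simp [T, alpha]
  | k + 1, σ, [], h => by simp at h
  | k + 1, σ, b :: w, h => by
    cases hn : σ.next none with
    | some τ =>
      rw [T_succ_of_some hn]
      exact alpha_T_of_lt_length k τ _ (by omega)
    | none =>
      rw [T_succ_cons_of_none hn]
      cases σ.next (some b) with
      | none => rfl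
      | some τ => exact alpha_T_of_lt_length k τ w (by simpa using h)

theorem sum_fin_succ_dir {M : Type*} [AddCommMonoid M] (i : ℕ) (f : (Fin (i + 1) → Dir) → M) :
    ∑ w, f w = ∑ w : Fin i → Dir, f (Fin.cons .L w) + ∑ w : Fin i → Dir, f (Fin.cons .R w) := by
  rw [← (Fin.consEquiv fun _ => Dir).sum_comp, Fintype.sum_prod_type]
  change ∑ b ∈ ({.L, .R} : Finset Dir), _ = _
  rw [Finset.sum_pair (by decide)]
  rfl

/-- A deterministic step leaves the word alone, and the additional length `k + 1` contributes
nothing. At a probabilistic step the empty word dies and the others are sorted by their first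
letter. -/
theorem sum_alpha_T (k : ℕ) (σ : State) :
    ∑ i ∈ Finset.range (k + 1), ∑ w : Fin i → Dir, alpha (T k σ (List.ofFn w)) = haltAt k σ := by
  induction k generalizing σ with
  | zero => simp [T, haltAt]
  | succ k ih =>
    cases hn : σ.next none with
    | some τ =>
      simp only [T_succ_of_some hn]
      rw [Finset.sum_range_succ, ih, haltAt, hn]
      simp only [add_eq_left]
      exact Finset.sum_eq_zero fun w _ => alpha_T_of_lt_length _ _ _ (by simp)
    | none =>
      rw [Finset.sum_range_succ']
      have h0 : ∑ w : Fin 0 → Dir, alpha (T (k + 1) σ (List.ofFn w)) = 0 := by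
        simp [T_succ_nil_of_none hn, alpha]
      have hb (b : Dir) : ∑ i ∈ Finset.range (k + 1), ∑ w : Fin i → Dir,
          alpha (T (k + 1) σ (List.ofFn (Fin.cons b w : Fin (i + 1) → Dir)))
          = (σ.next (some b)).elim 0 (haltAt k) := by
        simp only [List.ofFn_cons, T_succ_cons_of_none hn]
        cases σ.next (some b) with
        | none => simp [alpha]
        | some τ => simpa using ih τ
      simp only [h0, add_zero, sum_fin_succ_dir]
      rw [Finset.sum_add_distrib, hb, hb, haltAt, hn]

/-! ### Weights and histories factor out -/

/-- Prefix the run leading to `τ` by one of probability `a` with choices `θ`. -/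
def State.prepend (a : ℚ≥0) (θ : List Dir) (τ : State) : State :=
  ⟨τ.ctrl, τ.val, a * τ.prob, θ ++ τ.hist⟩

/-- A step multiplies the weight and extends the choice word but never reads either, so every run
can be normalised to weight `1` and empty history. -/
theorem nextProg_prepend (η : Val) (a : ℚ≥0) (θ : List Dir) (P : Prog) (b : Option Dir) :
    nextProg η a θ P b = (nextProg η 1 [] P b).map (State.prepend a θ) := by
  induction P with
  | assign v e => rcases b with _ | b <;> simp [nextProg, State.prepend]
  | seq P Q ihP _ =>
    simp only [nextProg]
    rw [ihP]
    cases nextProg η 1 [] P b <;> simp [State.prepend]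
  | choice p P Q => rcases b with _ | _ | _ <;> simp [nextProg, State.prepend]
  | _ c P =>
    rcases b with _ | b <;> simp only [nextProg]
    · split_ifs <;> simp [State.prepend]
    · simp

theorem nextCtrl_seq {c : Ctrl} (hc : c ≠ .halt) (η : Val) (a : ℚ≥0) (θ : List Dir) (Q : Prog)
    (b : Option Dir) : nextCtrl η a θ (.seq c Q) b =
      (nextCtrl η a θ c b).map fun τ => { τ with ctrl := .seq τ.ctrl Q } := by
  cases c with
  | halt => exact absurd rfl hc
  | run P => cases b <;> rfl
  | seq c R => cases b <;> rfl

theorem nextCtrl_prepend (η : Val) (a : ℚ≥0) (θ : List Dir) (c : Ctrl) (b : Option Dir) :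
    nextCtrl η a θ c b = (nextCtrl η 1 [] c b).map (State.prepend a θ) := by
  induction c with
  | halt => simp [nextCtrl]
  | run P => simpa [nextCtrl] using nextProg_prepend η a θ P b
  | seq c Q ih =>
    by_cases hc : c = .halt
    · subst hc
      rcases b with _ | b <;> simp [nextCtrl, State.prepend]
    · rw [nextCtrl_seq hc, nextCtrl_seq hc, ih]
      cases nextCtrl η 1 [] c b <;> simp [State.prepend]

/-- The probability that the remainder `c` with valuation `η` halts after exactly `k` steps. -/
def haltIn (k : ℕ) (c : Ctrl) (η : Val) : ℚ≥0 := haltAt k ⟨c, η, 1, []⟩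

theorem haltAt_eq (k : ℕ) (σ : State) : haltAt k σ = σ.prob * haltIn k σ.ctrl σ.val := by
  induction k generalizing σ with
  | zero => rcases σ with ⟨_ | _ | _, η, a, θ⟩ <;> simp [haltIn, haltAt, alpha]
  | succ k ih =>
    have key (b : Option Dir) : σ.next b =
        (State.next ⟨σ.ctrl, σ.val, 1, []⟩ b).map (State.prepend σ.prob σ.hist) :=
      nextCtrl_prepend ..
    rw [haltIn, haltAt, haltAt, key, key, key]
    have hel (o : Option State) : (o.map (State.prepend σ.prob σ.hist)).elim 0 (haltAt k)
        = σ.prob * o.elim 0 (haltAt k) := by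
      cases o with
      | none => simp
      | some τ =>
        simp only [Option.map_some, Option.elim_some]
        rw [ih, ih τ]
        simp [State.prepend, mul_assoc]
    cases State.next ⟨σ.ctrl, σ.val, 1, []⟩ none with
    | some τ => simpa using hel (some τ)
    | none => simp only [Option.map_none]; rw [hel, hel, mul_add]

/-- The probability that the remainder `c` with valuation `η` halts in fewer than `n` steps. -/
def haltBefore (n : ℕ) (c : Ctrl) (η : Val) : ℚ≥0 := ∑ k ∈ Finset.range n, haltIn k c η

theorem haltBefore_mono {n n' : ℕ} (h : n ≤ n') (c : Ctrl) (η : Val) :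
    haltBefore n c η ≤ haltBefore n' c η :=
  Finset.sum_le_sum_of_subset (Finset.range_subset_range.2 h)

theorem termProb_eq_iSup_haltBefore (P : Prog) (η : Val) :
    termProb P η = ⨆ n, (((haltBefore n (.run P) η : ℚ≥0) : ℝ≥0) : ℝ≥0∞) := by
  rw [termProb, ENNReal.tsum_eq_iSup_nat]
  refine iSup_congr fun n => ?_
  rw [haltBefore, NNRat.cast_sum, ENNReal.ofNNReal_finsetSum]
  refine Finset.sum_congr rfl fun k _ => ?_
  rw [haltIn, ← sum_alpha_T]
  simp only [NNRat.cast_sum, ENNReal.ofNNReal_finsetSum]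
  rfl

theorem haltBefore_zero (c : Ctrl) (η : Val) : haltBefore 0 c η = 0 := by simp [haltBefore]

theorem haltBefore_succ_halt (n : ℕ) (η : Val) : haltBefore (n + 1) .halt η = 1 := by
  rw [haltBefore, Finset.sum_range_succ']
  simp [haltIn, haltAt, State.next, nextCtrl, alpha]

theorem haltIn_zero {c : Ctrl} (hc : c ≠ .halt) (η : Val) : haltIn 0 c η = 0 := by
  cases c <;> simp [haltIn, haltAt, alpha] at hc ⊢

theorem haltBefore_succ_of_some {c : Ctrl} (hc : c ≠ .halt) {η : Val} {τ : State}
    (h : nextCtrl η 1 [] c none = some τ) (n : ℕ) :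
    haltBefore (n + 1) c η = τ.prob * haltBefore n τ.ctrl τ.val := by
  rw [haltBefore, Finset.sum_range_succ', haltIn_zero hc, add_zero, haltBefore, Finset.mul_sum]
  refine Finset.sum_congr rfl fun k _ => ?_
  rw [haltIn, haltAt, State.next, h]
  exact haltAt_eq _ _

theorem haltBefore_succ_of_none {c : Ctrl} (hc : c ≠ .halt) {η : Val} {τ τ' : State}
    (h : nextCtrl η 1 [] c none = none) (hL : nextCtrl η 1 [] c (some .L) = some τ)
    (hR : nextCtrl η 1 [] c (some .R) = some τ') (n : ℕ) :
    haltBefore (n + 1) c η =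
      τ.prob * haltBefore n τ.ctrl τ.val + τ'.prob * haltBefore n τ'.ctrl τ'.val := by
  rw [haltBefore, Finset.sum_range_succ', haltIn_zero hc, add_zero, haltBefore, haltBefore,
    Finset.mul_sum, Finset.mul_sum, ← Finset.sum_add_distrib]
  refine Finset.sum_congr rfl fun k _ => ?_
  rw [haltIn, haltAt]
  simp only [State.next, h, hL, hR, Option.elim_some]
  rw [haltAt_eq, haltAt_eq]

/-! ### A stack machine with the same termination probability -/

/-- The probability that the stack machine with stack `s` and valuation `η` empties its stack
within `n` steps. -/
def stackHalt : ℕ → List Prog → Val → ℚ≥0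
  | _, [], _ => 1
  | 0, _ :: _, _ => 0
  | n + 1, .assign v e :: s, η => stackHalt n s (Function.update η v (e.eval η).toNNRat)
  | n + 1, .seq P Q :: s, η => stackHalt n (P :: Q :: s) η
  | n + 1, .choice p P Q :: s, η =>
    p.value * stackHalt n (P :: s) η + (1 - p.value) * stackHalt n (Q :: s) η
  | n + 1, .while b P :: s, η =>
    if b.eval η then stackHalt n (P :: .while b P :: s) η else stackHalt n s η

@[simp] theorem stackHalt_nil (n : ℕ) (η : Val) : stackHalt n [] η = 1 := by
  cases n <;> rfl

theorem stackHalt_le_succ (n : ℕ) (s : List Prog) (η : Val) :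
    stackHalt n s η ≤ stackHalt (n + 1) s η := by
  induction n generalizing s η with
  | zero => cases s <;> simp [stackHalt]
  | succ n ih =>
    rcases s with _ | ⟨_ | _ | _ | _, s⟩
    · simp
    · exact ih _ _
    · exact ih _ _
    · rw [stackHalt, stackHalt]
      gcongr <;> exact ih _ _
    · rw [stackHalt, stackHalt]
      split_ifs <;> exact ih _ _

theorem stackHalt_mono {n n' : ℕ} (h : n ≤ n') (s : List Prog) (η : Val) :
    stackHalt n s η ≤ stackHalt n' s η :=
  monotone_nat_of_le_succ (fun n => stackHalt_le_succ n s η) h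

theorem stackHalt_le_one (n : ℕ) (s : List Prog) (η : Val) : stackHalt n s η ≤ 1 := by
  induction n generalizing s η with
  | zero => cases s <;> simp [stackHalt]
  | succ n ih =>
    rcases s with _ | ⟨_ | _ | ⟨p, P, Q⟩ | _, s⟩
    · simp
    · exact ih _ _
    · exact ih _ _
    · rw [stackHalt]
      calc _ ≤ p.value * 1 + (1 - p.value) * 1 := by gcongr <;> exact ih _ _
        _ = 1 := by rw [mul_one, mul_one, add_tsub_cancel_of_le p.value_le_one]
    · rw [stackHalt]
      split_ifs <;> exact ih _ _

/-- The remainder `c; Q₁; …; Qₘ` for the stack `[Q₁, …, Qₘ]`. -/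
def resume (c : Ctrl) (s : List Prog) : Ctrl := s.foldl .seq c

theorem resume_ne_halt {c : Ctrl} (hc : c ≠ .halt) (s : List Prog) : resume c s ≠ .halt := by
  induction s generalizing c with
  | nil => exact hc
  | cons Q s ih => exact ih (c := .seq c Q) (by simp)

theorem nextCtrl_resume {c : Ctrl} (hc : c ≠ .halt) (η : Val) (a : ℚ≥0) (θ : List Dir)
    (s : List Prog) (b : Option Dir) : nextCtrl η a θ (resume c s) b =
      (nextCtrl η a θ c b).map fun τ => { τ with ctrl := resume τ.ctrl s } := by
  induction s generalizing c with
  | nil => simp [resume]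
  | cons Q s ih =>
    change nextCtrl η a θ (resume (.seq c Q) s) b = _
    rw [ih (by simp), nextCtrl_seq hc]
    cases nextCtrl η a θ c b <;> simp [resume]

theorem haltBefore_resume_halt_cons (n : ℕ) (Q : Prog) (s : List Prog) (η : Val) :
    haltBefore (n + 1) (resume .halt (Q :: s)) η = haltBefore n (resume (.run Q) s) η := by
  have h := haltBefore_succ_of_some (c := resume .halt (Q :: s)) (η := η)
    (τ := ⟨resume (.run Q) s, η, 1, []⟩) (resume_ne_halt (c := .seq .halt Q) (by simp) s)
    (by
      change nextCtrl η 1 [] (resume (.seq .halt Q) s) none = _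
      rw [nextCtrl_resume (by simp)]
      simp [nextCtrl]) n
  simpa using h

theorem haltBefore_resume_assign (n : ℕ) (v : Var) (e : AExp) (s : List Prog) (η : Val) :
    haltBefore (n + 1) (resume (.run (.assign v e)) s) η =
      haltBefore n (resume .halt s) (Function.update η v (e.eval η).toNNRat) := by
  have h := haltBefore_succ_of_some (c := resume (.run (.assign v e)) s) (η := η)
    (τ := ⟨resume .halt s, Function.update η v (e.eval η).toNNRat, 1, []⟩)
    (resume_ne_halt (by simp) s)
    (by rw [nextCtrl_resume (by simp)]; simp [nextCtrl, nextProg]) n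
  simpa using h

theorem haltIn_congr {c c' : Ctrl} (hc : c ≠ .halt) (hc' : c' ≠ .halt) {η : Val}
    (h : ∀ b, nextCtrl η 1 [] c b = nextCtrl η 1 [] c' b) (k : ℕ) :
    haltIn k c η = haltIn k c' η := by
  cases k with
  | zero => rw [haltIn_zero hc, haltIn_zero hc']
  | succ k => simp only [haltIn, haltAt, State.next, h]

/-- The remainders `run (P; Q)` and `(run P); Q` differ but have the same successors, so unfolding a
sequence costs no step here, whereas `stackHalt` charges one. -/
theorem haltBefore_resume_seq (n : ℕ) (P Q : Prog) (s : List Prog) (η : Val) :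
    haltBefore n (resume (.run (.seq P Q)) s) η = haltBefore n (resume (.run P) (Q :: s)) η := by
  refine Finset.sum_congr rfl fun k _ => ?_
  refine haltIn_congr (resume_ne_halt (by simp) s) (resume_ne_halt (by simp) _) (fun b => ?_) k
  change _ = nextCtrl η 1 [] (resume (.seq (.run P) Q) s) b
  rw [nextCtrl_resume (by simp), nextCtrl_resume (by simp), nextCtrl_seq (by simp)]
  rfl

theorem haltBefore_resume_choice (n : ℕ) (p : ProbLit) (P Q : Prog) (s : List Prog) (η : Val) :
    haltBefore (n + 1) (resume (.run (.choice p P Q)) s) η =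
      p.value * haltBefore n (resume (.run P) s) η +
        (1 - p.value) * haltBefore n (resume (.run Q) s) η := by
  have h := haltBefore_succ_of_none (c := resume (.run (.choice p P Q)) s) (η := η)
    (τ := ⟨resume (.run P) s, η, p.value, [.L]⟩) (τ' := ⟨resume (.run Q) s, η, 1 - p.value, [.R]⟩)
    (resume_ne_halt (by simp) s)
    (by rw [nextCtrl_resume (by simp)]; simp [nextCtrl, nextProg])
    (by rw [nextCtrl_resume (by simp)]; simp [nextCtrl, nextProg])
    (by rw [nextCtrl_resume (by simp)]; simp [nextCtrl, nextProg]) n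
  simpa using h

theorem haltBefore_resume_while (n : ℕ) (b : BExp) (P : Prog) (s : List Prog) (η : Val) :
    haltBefore (n + 1) (resume (.run (.while b P)) s) η =
      if b.eval η then haltBefore n (resume (.run P) (.while b P :: s)) η
      else haltBefore n (resume .halt s) η := by
  have h := haltBefore_succ_of_some (c := resume (.run (.while b P)) s) (η := η)
    (τ := ⟨if b.eval η then resume (.run (.seq P (.while b P))) s else resume .halt s, η, 1, []⟩)
    (resume_ne_halt (by simp) s)
    (by
      rw [nextCtrl_resume (by simp)]
      simp only [nextCtrl, nextProg]
      split_ifs <;> simp) n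
  rw [h]
  split_ifs <;> simp [haltBefore_resume_seq]

theorem exists_haltBefore_le_stackHalt_of_run {n : ℕ}
    (h : ∀ P s η, ∃ m, haltBefore n (resume (.run P) s) η ≤ stackHalt m (P :: s) η)
    (s : List Prog) (η : Val) : ∃ m, haltBefore n (resume .halt s) η ≤ stackHalt m s η := by
  cases s with
  | nil =>
    refine ⟨0, (haltBefore_mono n.le_succ _ _).trans ?_⟩
    change haltBefore (n + 1) .halt η ≤ _
    simp [haltBefore_succ_halt]
  | cons Q s =>
    obtain ⟨m, hm⟩ := h Q s η
    refine ⟨m, (haltBefore_mono n.le_succ _ _).trans ?_⟩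
    rwa [haltBefore_resume_halt_cons]

/-- The inner induction on `P` is needed because unfolding `P; Q` does not decrease `n`. -/
theorem exists_haltBefore_le_stackHalt (n : ℕ) (P : Prog) (s : List Prog) (η : Val) :
    ∃ m, haltBefore n (resume (.run P) s) η ≤ stackHalt m (P :: s) η := by
  induction n generalizing P s η with
  | zero => exact ⟨0, by simp [haltBefore_zero]⟩
  | succ n ih =>
    induction P generalizing s η with
    | assign v e =>
      obtain ⟨m, hm⟩ := exists_haltBefore_le_stackHalt_of_run ih s
        (Function.update η v (e.eval η).toNNRat)
      exact ⟨m + 1, by rwa [haltBefore_resume_assign, stackHalt]⟩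
    | seq P Q ihP _ =>
      obtain ⟨m, hm⟩ := ihP (Q :: s) η
      exact ⟨m + 1, by rwa [haltBefore_resume_seq, stackHalt]⟩
    | choice p P Q _ _ =>
      obtain ⟨m, hm⟩ := ih P s η
      obtain ⟨m', hm'⟩ := ih Q s η
      refine ⟨max m m' + 1, ?_⟩
      rw [haltBefore_resume_choice, stackHalt]
      gcongr
      · exact hm.trans (stackHalt_mono (le_max_left _ _) _ _)
      · exact hm'.trans (stackHalt_mono (le_max_right _ _) _ _)
    | _ b P _ =>
      obtain ⟨m, hm⟩ := ih P (.while b P :: s) η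
      obtain ⟨m', hm'⟩ := exists_haltBefore_le_stackHalt_of_run ih s η
      refine ⟨max m m' + 1, ?_⟩
      rw [haltBefore_resume_while, stackHalt]
      split_ifs
      · exact hm.trans (stackHalt_mono (le_max_left _ _) _ _)
      · exact hm'.trans (stackHalt_mono (le_max_right _ _) _ _)

/-- The given semantics spends an extra step on passing from `↓; Q` to `Q`, which the stack machine
does for free; hence the larger bounds `m + 1 + 1`. -/
theorem exists_stackHalt_le_haltBefore (n : ℕ) (s : List Prog) (η : Val) :
    ∃ m, stackHalt n s η ≤ haltBefore m (resume .halt s) η := by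
  have run {n : ℕ} {P : Prog} {s : List Prog} {η : Val} (h : ∃ m, stackHalt n (P :: s) η ≤
      haltBefore m (resume .halt (P :: s)) η) :
      ∃ m, stackHalt n (P :: s) η ≤ haltBefore m (resume (.run P) s) η := by
    obtain ⟨m, hm⟩ := h
    refine ⟨m, hm.trans ?_⟩
    rw [← haltBefore_resume_halt_cons]
    exact haltBefore_mono m.le_succ _ _
  induction n generalizing s η with
  | zero =>
    cases s with
    | nil => exact ⟨1, by rw [stackHalt_nil]; exact (haltBefore_succ_halt 0 η).ge⟩
    | cons P s => exact ⟨0, by simp [stackHalt]⟩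
  | succ n ih =>
    rcases s with _ | ⟨⟨v, e⟩ | ⟨P, Q⟩ | ⟨p, P, Q⟩ | ⟨b, P⟩, s⟩
    · exact ⟨1, by rw [stackHalt_nil]; exact (haltBefore_succ_halt 0 η).ge⟩
    · obtain ⟨m, hm⟩ := ih s (Function.update η v (e.eval η).toNNRat)
      exact ⟨m + 1 + 1, by rwa [haltBefore_resume_halt_cons, haltBefore_resume_assign, stackHalt]⟩
    · obtain ⟨m, hm⟩ := run (ih (P :: Q :: s) η)
      exact ⟨m + 1, by rwa [haltBefore_resume_halt_cons, haltBefore_resume_seq, stackHalt]⟩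
    · obtain ⟨m, hm⟩ := run (ih (P :: s) η)
      obtain ⟨m', hm'⟩ := run (ih (Q :: s) η)
      refine ⟨max m m' + 1 + 1, ?_⟩
      rw [haltBefore_resume_halt_cons, haltBefore_resume_choice, stackHalt]
      gcongr
      · exact hm.trans (haltBefore_mono (le_max_left _ _) _ _)
      · exact hm'.trans (haltBefore_mono (le_max_right _ _) _ _)
    · obtain ⟨m, hm⟩ := run (ih (P :: .while b P :: s) η)
      obtain ⟨m', hm'⟩ := ih s η
      refine ⟨max m m' + 1 + 1, ?_⟩
      rw [haltBefore_resume_halt_cons, haltBefore_resume_while, stackHalt]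
      split_ifs
      · exact hm.trans (haltBefore_mono (le_max_left _ _) _ _)
      · exact hm'.trans (haltBefore_mono (le_max_right _ _) _ _)

/-- The probability that the stack machine ever empties the stack `s`. -/
noncomputable def stackTerm (s : List Prog) (η : Val) : ℝ≥0∞ :=
  ⨆ n, (((stackHalt n s η : ℚ≥0) : ℝ≥0) : ℝ≥0∞)

theorem termProb_eq_stackTerm (P : Prog) (η : Val) : termProb P η = stackTerm [P] η := by
  rw [termProb_eq_iSup_haltBefore, stackTerm]
  apply le_antisymm <;> refine iSup_le fun n => ?_
  · obtain ⟨m, hm⟩ := exists_haltBefore_le_stackHalt n P [] η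
    exact le_iSup_of_le m (by exact_mod_cast hm)
  · obtain ⟨m, hm⟩ := exists_stackHalt_le_haltBefore n [P] η
    refine le_iSup_of_le m ?_
    have h : stackHalt n [P] η ≤ haltBefore m (.run P) η := by
      refine hm.trans ((haltBefore_mono m.le_succ _ _).trans ?_)
      rw [haltBefore_resume_halt_cons]
      rfl
    exact_mod_cast h

theorem stackTerm_le_one (s : List Prog) (η : Val) : stackTerm s η ≤ 1 :=
  iSup_le fun n => by exact_mod_cast stackHalt_le_one n s η

/-- The partial probabilities are monotone and bounded by `1`, so their supremum is `1` exactly when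
they pass the thresholds `n / (n + 1)`, which tend to `1`. Only comparisons of rationals remain. -/
theorem terminatesAS_iff (P : Prog) (η : Val) :
    TerminatesAS P η ↔ ∀ n : ℕ, ∃ k, (n : ℚ≥0) / (n + 1) ≤ stackHalt k [P] η := by
  rw [TerminatesAS, termProb_eq_stackTerm]
  constructor
  · intro h n
    have hlt : (((n : ℚ≥0) / (n + 1) : ℚ≥0) : ℝ≥0) < (1 : ℝ≥0) := by
      rw [← NNRat.cast_one (α := ℝ≥0), NNRat.cast_lt, div_lt_one (by positivity)]
      exact lt_add_one _
    have hlt' : ((((n : ℚ≥0) / (n + 1) : ℚ≥0) : ℝ≥0) : ℝ≥0∞) < stackTerm [P] η := by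
      rw [h]
      exact ENNReal.coe_lt_one_iff.2 hlt
    obtain ⟨k, hk⟩ := lt_iSup_iff.1 hlt'
    refine ⟨k, ?_⟩
    rw [ENNReal.coe_lt_coe, NNRat.cast_lt] at hk
    exact hk.le
  · intro h
    refine le_antisymm (stackTerm_le_one _ _) (le_of_forall_lt fun c hc => ?_)
    lift c to ℝ≥0 using hc.ne_top
    rw [ENNReal.coe_lt_one_iff] at hc
    obtain ⟨n, hn⟩ := exists_nat_gt ((1 - (c : ℝ))⁻¹)
    obtain ⟨k, hk⟩ := h n
    have hc' : (0 : ℝ) < 1 - c := sub_pos.2 (by exact_mod_cast hc)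
    have h1 : (c : ℝ) < n / (n + 1) := by
      rw [inv_lt_iff_one_lt_mul₀ hc'] at hn
      rw [lt_div_iff₀ (by positivity)]
      have : (c : ℝ) < 1 := by exact_mod_cast hc
      nlinarith
    have h2 : c < (((n : ℚ≥0) / (n + 1) : ℚ≥0) : ℝ≥0) := by
      rw [← NNReal.coe_lt_coe]
      push_cast
      exact h1
    have h3 : (((n : ℚ≥0) / (n + 1) : ℚ≥0) : ℝ≥0) ≤ ((stackHalt k [P] η : ℚ≥0) : ℝ≥0) :=
      NNRat.cast_le.2 hk
    exact lt_of_lt_of_le (ENNReal.coe_lt_coe.2 (h2.trans_le h3))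
      (le_iSup (fun n => (((stackHalt n [P] η : ℚ≥0) : ℝ≥0) : ℝ≥0∞)) k)

/-! ### Evaluation of expressions is primitive recursive -/

/-- Signed fractions: `(a, b, d)` denotes `(a - b) / (d + 1)`. -/
abbrev SFrac : Type := ℕ × ℕ × ℕ

namespace SFrac

/-- The rational denoted by a signed fraction. -/
def value (t : SFrac) : ℚ := ((t.1 : ℚ) - t.2.1) / (t.2.2 + 1)

/-- Addition of signed fractions. -/
def add (t u : SFrac) : SFrac :=
  -- Denominators are stored reduced by one: `(d + 1) * (d' + 1) = (d * d' + d + d') + 1`.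
  (t.1 * (u.2.2 + 1) + u.1 * (t.2.2 + 1), t.2.1 * (u.2.2 + 1) + u.2.1 * (t.2.2 + 1),
    t.2.2 * u.2.2 + t.2.2 + u.2.2)

/-- Subtraction of signed fractions. -/
def sub (t u : SFrac) : SFrac := add t (u.2.1, u.1, u.2.2)

/-- Multiplication of signed fractions. -/
def mul (t u : SFrac) : SFrac :=
  (t.1 * u.1 + t.2.1 * u.2.1, t.1 * u.2.1 + t.2.1 * u.1, t.2.2 * u.2.2 + t.2.2 + u.2.2)

/-- The fraction literal for the positive part of a signed fraction. -/
def toFracLit (t : SFrac) : FracLit := (t.1 - t.2.1, t.2.2)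

theorem value_add (t u : SFrac) : (add t u).value = t.value + u.value := by
  have h (n : ℕ) : (n : ℚ) + 1 ≠ 0 := by positivity
  have ht := h t.2.2
  have hu := h u.2.2
  have htu : (t.2.2 : ℚ) * u.2.2 + t.2.2 + u.2.2 + 1 = (t.2.2 + 1) * (u.2.2 + 1) := by ring
  simp only [add, value]
  push_cast
  rw [htu]
  field_simp
  ring

theorem value_sub (t u : SFrac) : (sub t u).value = t.value - u.value := by
  rw [sub, value_add, sub_eq_add_neg, add_right_inj]
  simp only [value]
  rw [← neg_div, neg_sub]

theorem value_mul (t u : SFrac) : (mul t u).value = t.value * u.value := by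
  have h (n : ℕ) : (n : ℚ) + 1 ≠ 0 := by positivity
  have ht := h t.2.2
  have hu := h u.2.2
  have htu : (t.2.2 : ℚ) * u.2.2 + t.2.2 + u.2.2 + 1 = (t.2.2 + 1) * (u.2.2 + 1) := by ring
  simp only [mul, value]
  push_cast
  rw [htu]
  field_simp
  ring

theorem value_toFracLit (t : SFrac) : t.toFracLit.value = t.value.toNNRat := by
  have hd : (0 : ℚ) < (t.2.2 : ℚ) + 1 := by positivity
  apply NNRat.coe_injective
  rcases le_total t.2.1 t.1 with h | h
  · have h' : (t.2.1 : ℚ) ≤ t.1 := by exact_mod_cast h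
    rw [value, Rat.coe_toNNRat _ (div_nonneg (by linarith) hd.le), FracLit.value, toFracLit]
    simp only [NNRat.coe_div, NNRat.coe_add, NNRat.coe_natCast, NNRat.coe_one]
    rw [Nat.cast_sub h]
  · have h' : (t.1 : ℚ) ≤ t.2.1 := by exact_mod_cast h
    rw [value, Rat.toNNRat_of_nonpos (div_nonpos_of_nonpos_of_nonneg (by linarith) hd.le), FracLit.value,
      toFracLit, Nat.sub_eq_zero_of_le h]
    simp

/-- Cross-multiplying and moving the subtracted parts across leaves a comparison of natural numbers,
so no signed arithmetic has to be shown primitive recursive. -/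
theorem value_eq_iff (t u : SFrac) : t.value = u.value ↔
    t.1 * (u.2.2 + 1) + u.2.1 * (t.2.2 + 1) = u.1 * (t.2.2 + 1) + t.2.1 * (u.2.2 + 1) := by
  have h (n : ℕ) : (n : ℚ) + 1 ≠ 0 := by positivity
  rw [value, value, div_eq_div_iff (h _) (h _), ← Nat.cast_inj (R := ℚ)]
  push_cast
  constructor <;> intro h <;> linarith

theorem value_lt_iff (t u : SFrac) : t.value < u.value ↔
    t.1 * (u.2.2 + 1) + u.2.1 * (t.2.2 + 1) < u.1 * (t.2.2 + 1) + t.2.1 * (u.2.2 + 1) := by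
  have h (n : ℕ) : (0 : ℚ) < (n : ℚ) + 1 := by positivity
  rw [value, value, div_lt_div_iff₀ (h _) (h _), ← Nat.cast_lt (α := ℚ)]
  push_cast
  constructor <;> intro h <;> linarith

theorem primrec_add : Primrec₂ add := by
  have ha : Primrec fun p : SFrac × SFrac => p.1.1 := .comp .fst .fst
  have hb : Primrec fun p : SFrac × SFrac => p.1.2.1 := .comp .fst (.comp .snd .fst)
  have hd : Primrec fun p : SFrac × SFrac => p.1.2.2 := .comp .snd (.comp .snd .fst)
  have ha' : Primrec fun p : SFrac × SFrac => p.2.1 := .comp .fst .snd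
  have hb' : Primrec fun p : SFrac × SFrac => p.2.2.1 := .comp .fst (.comp .snd .snd)
  have hd' : Primrec fun p : SFrac × SFrac => p.2.2.2 := .comp .snd (.comp .snd .snd)
  exact Primrec.pair
    (Primrec.nat_add.comp (Primrec.nat_mul.comp ha (Primrec.succ.comp hd'))
      (Primrec.nat_mul.comp ha' (Primrec.succ.comp hd)))
    (.pair (Primrec.nat_add.comp (Primrec.nat_mul.comp hb (Primrec.succ.comp hd'))
      (Primrec.nat_mul.comp hb' (Primrec.succ.comp hd)))
      (Primrec.nat_add.comp (Primrec.nat_add.comp (Primrec.nat_mul.comp hd hd') hd) hd'))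

theorem primrec_sub : Primrec₂ sub := by
  refine primrec_add.comp .fst ?_
  exact .pair (.comp .fst (.comp .snd .snd)) (.pair (.comp .fst .snd) (.comp .snd (.comp .snd .snd)))

theorem primrec_mul : Primrec₂ mul := by
  have ha : Primrec fun p : SFrac × SFrac => p.1.1 := .comp .fst .fst
  have hb : Primrec fun p : SFrac × SFrac => p.1.2.1 := .comp .fst (.comp .snd .fst)
  have hd : Primrec fun p : SFrac × SFrac => p.1.2.2 := .comp .snd (.comp .snd .fst)
  have ha' : Primrec fun p : SFrac × SFrac => p.2.1 := .comp .fst .snd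
  have hb' : Primrec fun p : SFrac × SFrac => p.2.2.1 := .comp .fst (.comp .snd .snd)
  have hd' : Primrec fun p : SFrac × SFrac => p.2.2.2 := .comp .snd (.comp .snd .snd)
  exact Primrec.pair
    (Primrec.nat_add.comp (Primrec.nat_mul.comp ha ha') (Primrec.nat_mul.comp hb hb'))
    (.pair (Primrec.nat_add.comp (Primrec.nat_mul.comp ha hb') (Primrec.nat_mul.comp hb ha'))
      (Primrec.nat_add.comp (Primrec.nat_add.comp (Primrec.nat_mul.comp hd hd') hd) hd'))

theorem primrec_toFracLit : Primrec toFracLit :=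
  .pair (Primrec.nat_sub.comp .fst (.comp .fst .snd)) (.comp .snd .snd)

theorem primrec_cross : Primrec₂ fun t u : SFrac => t.1 * (u.2.2 + 1) + u.2.1 * (t.2.2 + 1) := by
  refine Primrec₂.mk ?_
  repeat' first
    | exact Primrec.const _
    | exact Primrec.fst
    | exact Primrec.snd
    | refine Primrec.nat_add.comp ?_ ?_
    | refine Primrec.nat_mul.comp ?_ ?_
    | refine Primrec.fst.comp ?_
    | refine Primrec.snd.comp ?_

theorem primrecRel_value_eq : PrimrecRel fun t u : SFrac => t.value = u.value :=
  PrimrecPred.of_eq (Primrec.eq.comp primrec_cross primrec_cross.swap) fun p =>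
    (value_eq_iff p.1 p.2).symm

theorem primrecRel_value_lt : PrimrecRel fun t u : SFrac => t.value < u.value :=
  PrimrecPred.of_eq (Primrec.nat_lt.comp primrec_cross primrec_cross.swap) fun p =>
    (value_lt_iff p.1 p.2).symm

end SFrac

theorem getD_map_range {σ : Type*} (f : ℕ → σ) {i n : ℕ} (h : i < n) (d : σ) :
    ((List.range n).map f).getD i d = f i := by
  simp [List.getD, h]

/-- Evaluation of an arithmetical expression on a finitely presented valuation. -/
def AExp.evalFrac (l : List FracLit) : AExp → SFrac
  | .lit q => (q.1, 0, q.2)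
  | .var v => ((l.getD v (0, 0)).1, 0, (l.getD v (0, 0)).2)
  | .add e₁ e₂ => (e₁.evalFrac l).add (e₂.evalFrac l)
  | .sub e₁ e₂ => (e₁.evalFrac l).sub (e₂.evalFrac l)
  | .mul e₁ e₂ => (e₁.evalFrac l).mul (e₂.evalFrac l)

theorem AExp.value_evalFrac (l : List FracLit) (e : AExp) :
    (e.evalFrac l).value = e.eval (inputOf l) := by
  induction e with
  | lit q => simp [evalFrac, eval, SFrac.value, FracLit.value]
  | var v => simp [evalFrac, eval, SFrac.value, inputOf, FracLit.value]
  | add a b iha ihb => rw [evalFrac, SFrac.value_add, iha, ihb, eval]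
  | sub a b iha ihb => rw [evalFrac, SFrac.value_sub, iha, ihb, eval]
  | mul a b iha ihb => rw [evalFrac, SFrac.value_mul, iha, ihb, eval]

theorem primrec_unpair_div {α : Type*} [Primcodable α] {f : α → ℕ} (hf : Primrec f) (k : ℕ) :
    Primrec fun a => Nat.unpair (f a / k) :=
  Primrec.unpair.comp (Primrec.nat_div.comp hf (.const k))

theorem primrecPred_mod_eq {α : Type*} [Primcodable α] {f : α → ℕ} (hf : Primrec f) (k r : ℕ) :
    PrimrecPred fun a => f a % k = r :=
  Primrec.eq.comp (Primrec.nat_mod.comp hf (.const k)) (.const r)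

/-- Course-of-values recursion on the Gödel number: `L` lists the values for all smaller codes, so
`L.length` is the current code. Codes of subexpressions are strictly smaller, hence the defaults of
`getD` on `L` are never used. -/
theorem AExp.primrec_evalFrac : Primrec₂ fun (l : List FracLit) (e : AExp) => e.evalFrac l := by
  have hlen : Primrec fun p : List FracLit × List SFrac => p.2.length :=
    Primrec.list_length.comp .snd
  have hu := primrec_unpair_div hlen 5
  have hx : Primrec fun p : List FracLit × List SFrac =>
      p.2.getD (Nat.unpair (p.2.length / 5)).1 (0, 0, 0) :=
    (Primrec.list_getD _).comp .snd (.comp .fst hu)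
  have hy : Primrec fun p : List FracLit × List SFrac =>
      p.2.getD (Nat.unpair (p.2.length / 5)).2 (0, 0, 0) :=
    (Primrec.list_getD _).comp .snd (.comp .snd hu)
  have hv : Primrec fun p : List FracLit × List SFrac => p.1.getD (p.2.length / 5) (0, 0) :=
    (Primrec.list_getD _).comp .fst (Primrec.nat_div.comp hlen (.const 5))
  have key : Primrec₂ fun (l : List FracLit) (n : ℕ) => (AExp.ofCode n).evalFrac l := by
    refine Primrec.nat_strong_rec _ (g := fun l L => some
      (if L.length % 5 = 0 then
        ((Nat.unpair (L.length / 5)).1, 0, (Nat.unpair (L.length / 5)).2)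
      else if L.length % 5 = 1 then
        ((l.getD (L.length / 5) (0, 0)).1, 0, (l.getD (L.length / 5) (0, 0)).2)
      else if L.length % 5 = 2 then SFrac.add (L.getD (Nat.unpair (L.length / 5)).1 (0, 0, 0))
        (L.getD (Nat.unpair (L.length / 5)).2 (0, 0, 0))
      else if L.length % 5 = 3 then SFrac.sub (L.getD (Nat.unpair (L.length / 5)).1 (0, 0, 0))
        (L.getD (Nat.unpair (L.length / 5)).2 (0, 0, 0))
      else SFrac.mul (L.getD (Nat.unpair (L.length / 5)).1 (0, 0, 0))
        (L.getD (Nat.unpair (L.length / 5)).2 (0, 0, 0)))) ?_ ?_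
    · refine Primrec.option_some.comp (.ite (primrecPred_mod_eq hlen 5 0)
        (.pair (.comp .fst hu) (.pair (.const 0) (.comp .snd hu)))
        (.ite (primrecPred_mod_eq hlen 5 1)
          (.pair (.comp .fst hv) (.pair (.const 0) (.comp .snd hv)))
          (.ite (primrecPred_mod_eq hlen 5 2) (SFrac.primrec_add.comp hx hy)
            (.ite (primrecPred_mod_eq hlen 5 3) (SFrac.primrec_sub.comp hx hy)
              (SFrac.primrec_mul.comp hx hy)))))
    · intro l n
      have hl := Nat.unpair_left_le (n / 5)
      have hr := Nat.unpair_right_le (n / 5)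
      rw [List.length_map, List.length_range, AExp.ofCode]
      congr 1
      split_ifs with h0 h1 h2 h3
      · rfl
      · rfl
      all_goals
        rw [getD_map_range _ (by omega), getD_map_range _ (by omega)]
        rfl
  refine (key.comp .fst (Primrec.encode.comp .snd)).of_eq fun p => ?_
  change (AExp.ofCode p.2.code).evalFrac p.1 = _
  rw [AExp.ofCode_code]

theorem BExp.primrec_eval :
    Primrec₂ fun (l : List FracLit) (b : BExp) => b.eval (inputOf l) := by
  have hlen : Primrec fun p : List FracLit × List Bool => p.2.length :=
    Primrec.list_length.comp .snd
  have hu := primrec_unpair_div hlen 4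
  have hx : Primrec fun p : List FracLit × List Bool =>
      p.2.getD (Nat.unpair (p.2.length / 4)).1 false :=
    (Primrec.list_getD _).comp .snd (.comp .fst hu)
  have hy : Primrec fun p : List FracLit × List Bool =>
      p.2.getD (Nat.unpair (p.2.length / 4)).2 false :=
    (Primrec.list_getD _).comp .snd (.comp .snd hu)
  have hz : Primrec fun p : List FracLit × List Bool => p.2.getD (p.2.length / 4) false :=
    (Primrec.list_getD _).comp .snd (Primrec.nat_div.comp hlen (.const 4))
  have ha : Primrec fun p : List FracLit × List Bool =>
      (AExp.ofCode (Nat.unpair (p.2.length / 4)).1).evalFrac p.1 :=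
    AExp.primrec_evalFrac.comp .fst ((Primrec.ofNat AExp).comp (.comp .fst hu))
  have hb : Primrec fun p : List FracLit × List Bool =>
      (AExp.ofCode (Nat.unpair (p.2.length / 4)).2).evalFrac p.1 :=
    AExp.primrec_evalFrac.comp .fst ((Primrec.ofNat AExp).comp (.comp .snd hu))
  have key : Primrec₂ fun (l : List FracLit) (n : ℕ) => (BExp.ofCode n).eval (inputOf l) := by
    refine Primrec.nat_strong_rec _ (g := fun l L => some
      (if L.length % 4 = 0 then
        decide (((AExp.ofCode (Nat.unpair (L.length / 4)).1).evalFrac l).value =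
          ((AExp.ofCode (Nat.unpair (L.length / 4)).2).evalFrac l).value)
      else if L.length % 4 = 1 then
        decide (((AExp.ofCode (Nat.unpair (L.length / 4)).1).evalFrac l).value <
          ((AExp.ofCode (Nat.unpair (L.length / 4)).2).evalFrac l).value)
      else if L.length % 4 = 2 then !(L.getD (L.length / 4) false)
      else (L.getD (Nat.unpair (L.length / 4)).1 false) &&
        (L.getD (Nat.unpair (L.length / 4)).2 false))) ?_ ?_
    · refine Primrec.option_some.comp (.ite (primrecPred_mod_eq hlen 4 0)
        (SFrac.primrecRel_value_eq.comp ha hb).decide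
        (.ite (primrecPred_mod_eq hlen 4 1) (SFrac.primrecRel_value_lt.comp ha hb).decide
          (.ite (primrecPred_mod_eq hlen 4 2) (Primrec.not.comp hz) (Primrec.and.comp hx hy))))
    · intro l n
      have hl := Nat.unpair_left_le (n / 4)
      have hr := Nat.unpair_right_le (n / 4)
      rw [List.length_map, List.length_range, BExp.ofCode]
      congr 1
      split_ifs with h0 h1 h2
      · simp only [AExp.value_evalFrac, BExp.eval]
      · simp only [AExp.value_evalFrac, BExp.eval]
      · rw [getD_map_range _ (by omega)]
        rfl
      · rw [getD_map_range _ (by omega), getD_map_range _ (by omega)]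
        rfl
  refine (key.comp .fst (Primrec.encode.comp .snd)).of_eq fun p => ?_
  change (BExp.ofCode p.2.code).eval (inputOf p.1) = _
  rw [BExp.ofCode_code]

/-! ### Breadth-first execution -/

/-- Update of a finitely presented valuation. -/
def updateInput (l : List FracLit) (v : Var) (q : FracLit) : List FracLit :=
  (List.range (max l.length (v + 1))).map fun w => if w = v then q else l.getD w (0, 0)

theorem inputOf_updateInput (l : List FracLit) (v : Var) (q : FracLit) :
    inputOf (updateInput l v q) = Function.update (inputOf l) v q.value := by
  funext w
  rw [inputOf, Function.update_apply]
  by_cases hw : w < max l.length (v + 1)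
  · rw [updateInput, getD_map_range _ hw]
    split_ifs <;> rfl
  · rw [not_lt, max_le_iff] at hw
    have hwv : w ≠ v := by rintro rfl; exact Nat.not_succ_le_self _ hw.2
    have hlen : (updateInput l v q).length ≤ w := by simpa [updateInput] using hw
    rw [if_neg hwv, List.getD_eq_default _ _ hlen, inputOf, List.getD_eq_default _ _ hw.1]

theorem primrec_updateInput :
    Primrec fun p : List FracLit × Var × FracLit => updateInput p.1 p.2.1 p.2.2 := by
  refine Primrec.list_map (Primrec.list_range.comp (Primrec.nat_max.comp
    (Primrec.list_length.comp .fst) (Primrec.succ.comp (.comp .fst .snd)))) ?_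
  exact .ite (Primrec.eq.comp .snd (.comp .fst (.comp .snd .fst))) (.comp .snd (.comp .snd .fst))
    ((Primrec.list_getD _).comp (.comp .fst .fst) .snd)

/-! ### Arithmetic of weights -/

/-- Addition of fraction literals. -/
def FracLit.add (p q : FracLit) : FracLit :=
  (p.1 * (q.2 + 1) + q.1 * (p.2 + 1), p.2 * q.2 + p.2 + q.2)

/-- Multiplication of fraction literals. -/
def FracLit.mul (p q : FracLit) : FracLit := (p.1 * q.1, p.2 * q.2 + p.2 + q.2)

theorem FracLit.value_add (p q : FracLit) : (p.add q).value = p.value + q.value := by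
  have h (n : ℕ) : (n : ℚ≥0) + 1 ≠ 0 := by positivity
  have hpq : (p.2 : ℚ≥0) * q.2 + p.2 + q.2 + 1 = (p.2 + 1) * (q.2 + 1) := by ring
  simp only [add, value]
  push_cast
  rw [hpq, div_add_div _ _ (h _) (h _)]
  ring

theorem FracLit.value_mul (p q : FracLit) : (p.mul q).value = p.value * q.value := by
  have hpq : (p.2 : ℚ≥0) * q.2 + p.2 + q.2 + 1 = (p.2 + 1) * (q.2 + 1) := by ring
  simp only [mul, value]
  push_cast
  rw [hpq, div_mul_div_comm]

theorem FracLit.primrec_add : Primrec₂ FracLit.add := by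
  refine Primrec₂.mk ?_
  unfold FracLit.add
  repeat' first
    | exact Primrec.const _
    | exact Primrec.fst
    | exact Primrec.snd
    | refine Primrec.pair ?_ ?_
    | refine Primrec.nat_add.comp ?_ ?_
    | refine Primrec.nat_mul.comp ?_ ?_
    | refine Primrec.fst.comp ?_
    | refine Primrec.snd.comp ?_

theorem FracLit.primrec_mul : Primrec₂ FracLit.mul := by
  refine Primrec₂.mk ?_
  unfold FracLit.mul
  repeat' first
    | exact Primrec.const _
    | exact Primrec.fst
    | exact Primrec.snd
    | refine Primrec.pair ?_ ?_
    | refine Primrec.nat_add.comp ?_ ?_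
    | refine Primrec.nat_mul.comp ?_ ?_
    | refine Primrec.fst.comp ?_
    | refine Primrec.snd.comp ?_

/-! ### Weighted configurations and their successors -/

/-- Weighted configurations of the stack machine: stack, valuation and weight. -/
abbrev Config : Type := List Prog × List FracLit × FracLit

/-- Successors of a configuration whose topmost program has code `n`. -/
def stepCode (n : ℕ) (c : Config) : List Config :=
  if n % 4 = 0 then
    [(c.1, updateInput c.2.1 (Nat.unpair (n / 4)).1
      ((AExp.ofCode (Nat.unpair (n / 4)).2).evalFrac c.2.1).toFracLit, c.2.2)]
  else if n % 4 = 1 then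
    [(.ofCode (Nat.unpair (n / 4)).1 :: .ofCode (Nat.unpair (n / 4)).2 :: c.1, c.2)]
  else if n % 4 = 2 then
    -- The code of a `ProbLit` is its pair of odds minus one, so `+ 1` recovers the odds; the `- 1`
    -- in the denominator matches the shift in `FracLit`.
    [(.ofCode (Nat.unpair (Nat.unpair (n / 4)).2).1 :: c.1, c.2.1,
      c.2.2.mul ((Nat.unpair ((Nat.unpair (n / 4)).1 + 1)).1,
        (Nat.unpair ((Nat.unpair (n / 4)).1 + 1)).1 +
          (Nat.unpair ((Nat.unpair (n / 4)).1 + 1)).2 - 1)),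
    (.ofCode (Nat.unpair (Nat.unpair (n / 4)).2).2 :: c.1, c.2.1,
      c.2.2.mul ((Nat.unpair ((Nat.unpair (n / 4)).1 + 1)).2,
        (Nat.unpair ((Nat.unpair (n / 4)).1 + 1)).1 +
          (Nat.unpair ((Nat.unpair (n / 4)).1 + 1)).2 - 1))]
  else if (BExp.ofCode (Nat.unpair (n / 4)).1).eval (inputOf c.2.1) = true then
    [(.ofCode (Nat.unpair (n / 4)).2 :: .ofCode n :: c.1, c.2)]
  -- The stack in `c` is already the part below the loop, so keeping `c` pops the loop.
  else [c]

/-- Successors of a configuration. -/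
def stepConfig (c : Config) : List Config :=
  match c.1 with
  -- Halted configurations are kept, so their weight still counts at every later level.
  | [] => [c]
  | P :: s => stepCode P.code (s, c.2)

theorem primrec_list_singleton {α β : Type*} [Primcodable α] [Primcodable β] {f : α → β}
    (hf : Primrec f) : Primrec fun a => [f a] :=
  Primrec.list_cons.comp hf (.const [])

theorem primrec_stepCode : Primrec₂ stepCode := by
  have hn : Primrec fun p : ℕ × Config => p.1 := .fst
  have hs : Primrec fun p : ℕ × Config => p.2.1 := .comp .fst .snd
  have hl : Primrec fun p : ℕ × Config => p.2.2.1 := .comp .fst (.comp .snd .snd)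
  have hw : Primrec fun p : ℕ × Config => p.2.2.2 := .comp .snd (.comp .snd .snd)
  have hlw : Primrec fun p : ℕ × Config => p.2.2 := .comp .snd .snd
  have hu := primrec_unpair_div hn 4
  have hu₁ := Primrec.fst.comp hu
  have hu₂ := Primrec.snd.comp hu
  have huu := Primrec.unpair.comp hu₂
  have hp := Primrec.unpair.comp (Primrec.succ.comp hu₁)
  have hsum := Primrec.nat_sub.comp
    (Primrec.nat_add.comp (Primrec.fst.comp hp) (Primrec.snd.comp hp)) (.const 1)
  have hP {f : ℕ × Config → ℕ} (hf : Primrec f) : Primrec fun p => Prog.ofCode (f p) :=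
    (Primrec.ofNat Prog).comp hf
  have hcons {f : ℕ × Config → ℕ} {g : ℕ × Config → List Prog} (hf : Primrec f)
      (hg : Primrec g) : Primrec fun p => Prog.ofCode (f p) :: g p :=
    Primrec.list_cons.comp (hP hf) hg
  refine Primrec.ite (primrecPred_mod_eq hn 4 0) (primrec_list_singleton ?_)
    (.ite (primrecPred_mod_eq hn 4 1) (primrec_list_singleton ?_)
    (.ite (primrecPred_mod_eq hn 4 2) (Primrec.list_cons.comp ?_ (primrec_list_singleton ?_))
    (.ite ?_ (primrec_list_singleton ?_) (primrec_list_singleton .snd))))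
  · exact .pair hs (.pair (primrec_updateInput.comp (.pair hl (.pair hu₁
      (SFrac.primrec_toFracLit.comp
        (AExp.primrec_evalFrac.comp hl ((Primrec.ofNat AExp).comp hu₂)))))) hw)
  · exact .pair (hcons hu₁ (hcons hu₂ hs)) hlw
  · exact .pair (hcons (.comp .fst huu) hs)
      (.pair hl (FracLit.primrec_mul.comp hw (.pair (.comp .fst hp) hsum)))
  · exact .pair (hcons (.comp .snd huu) hs)
      (.pair hl (FracLit.primrec_mul.comp hw (.pair (.comp .snd hp) hsum)))
  · exact Primrec.eq.comp (BExp.primrec_eval.comp hl ((Primrec.ofNat BExp).comp hu₁)) (.const true)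
  · exact .pair (hcons hu₂ (hcons hn hs)) hlw

theorem primrec_stepConfig : Primrec stepConfig := by
  refine (Primrec.list_casesOn (f := fun c : Config => c.1) (g := fun c => [c])
    (h := fun c x => stepCode x.1.code (x.2, c.2)) .fst (primrec_list_singleton .id) ?_).of_eq ?_
  · exact primrec_stepCode.comp (Primrec.encode.comp (.comp .fst .snd))
      (.pair (.comp .snd .snd) (.comp .snd .fst))
  · rintro ⟨_ | ⟨P, s⟩, c⟩ <;> rfl

/-- The total weight of the halted configurations in a list. -/
def haltedWeight (L : List Config) : FracLit :=
  L.foldr (fun c q => if c.1.length = 0 then c.2.2.add q else q) (0, 0)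

theorem primrec_haltedWeight : Primrec haltedWeight := by
  refine Primrec.list_foldr (h := fun _ (x : Config × FracLit) =>
    if x.1.1.length = 0 then x.1.2.2.add x.2 else x.2) .id (.const (0, 0)) ?_
  exact .ite (Primrec.eq.comp (Primrec.list_length.comp (.comp .fst (.comp .fst .snd))) (.const 0))
    (FracLit.primrec_add.comp (.comp .snd (.comp .snd (.comp .fst .snd))) (.comp .snd .snd))
    (.comp .snd .snd)

/-- The expected weight that has halted within `n` steps from the configuration `c`. -/
def Config.haltWeight (n : ℕ) (c : Config) : ℚ≥0 :=
  c.2.2.value * stackHalt n c.1 (inputOf c.2.1)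

theorem value_odds_left (p : ProbLit) :
    FracLit.value (p.left, p.left + p.right - 1) = p.value := by
  have hp := p.pos
  rw [FracLit.value, ProbLit.value]
  congr 1
  rw [← Nat.cast_add_one, Nat.sub_add_cancel hp, Nat.cast_add]

theorem value_odds_right (p : ProbLit) :
    FracLit.value (p.right, p.left + p.right - 1) = 1 - p.value := by
  have hp := p.pos
  have h0 : (p.left : ℚ≥0) + p.right ≠ 0 := by exact_mod_cast hp.ne'
  refine eq_tsub_of_add_eq ?_
  rw [FracLit.value, ProbLit.value, ← Nat.cast_add_one, Nat.sub_add_cancel hp, Nat.cast_add,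
    ← add_div, add_comm (p.right : ℚ≥0), div_self h0]

/-- One breadth-first level is one unfolding of `stackHalt`, with the branch probabilities moved
into the weights. -/
theorem sum_haltWeight_stepConfig (n : ℕ) (c : Config) :
    ((stepConfig c).map (Config.haltWeight n)).sum = c.haltWeight (n + 1) := by
  have h1 (m : ℕ) : (4 * m + 1) % 4 = 1 ∧ (4 * m + 1) / 4 = m := by omega
  have h2 (m : ℕ) : (4 * m + 2) % 4 = 2 ∧ (4 * m + 2) / 4 = m := by omega
  have h3 (m : ℕ) : (4 * m + 3) % 4 = 3 ∧ (4 * m + 3) / 4 = m := by omega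
  obtain ⟨s, l, w⟩ := c
  rcases s with _ | ⟨⟨v, e⟩ | ⟨P, Q⟩ | ⟨p, P, Q⟩ | ⟨b, P⟩, s⟩
  · simp [stepConfig, Config.haltWeight]
  · simp [stepConfig, stepCode, Config.haltWeight, Prog.code, AExp.ofCode_code, stackHalt,
      inputOf_updateInput, SFrac.value_toFracLit, AExp.value_evalFrac]
  · simp [stepConfig, stepCode, Config.haltWeight, Prog.code, h1, Prog.ofCode_code, stackHalt]
  · have hp : Nat.unpair (ProbLit.equivNat p + 1) = (p.left, p.right) := by
      have := ProbLit.equivNat.symm_apply_apply p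
      exact Prod.ext (congrArg ProbLit.left this) (congrArg ProbLit.right this)
    simp [stepConfig, stepCode, Config.haltWeight, Prog.code, h2, Prog.ofCode_code, stackHalt, hp,
      FracLit.value_mul, value_odds_left, value_odds_right, mul_add, mul_assoc]
  · have hw : Prog.ofCode (4 * Nat.pair b.code P.code + 3) = .while b P :=
      Prog.ofCode_code (.while b P)
    by_cases hb : b.eval (inputOf l) = true <;>
    simp [stepConfig, stepCode, Config.haltWeight, Prog.code, h3, Prog.ofCode_code, stackHalt, hw,
      BExp.ofCode_code, hb]

/-- The list is arbitrary because the induction peels off the first level, which turns a single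
configuration into several. For `n = 0`, `stackHalt` is the indicator of the empty stack. -/
theorem value_haltedWeight_iterate (n : ℕ) (L : List Config) :
    (haltedWeight ((fun L => L.flatMap stepConfig)^[n] L)).value =
      (L.map (Config.haltWeight n)).sum := by
  induction n generalizing L with
  | zero =>
    induction L with
    | nil => simp [haltedWeight, FracLit.value]
    | cons c L ih =>
      obtain ⟨s, l, w⟩ := c
      simp only [Function.iterate_zero, id_eq, List.map_cons, List.sum_cons] at ih ⊢
      rw [← ih]
      cases s <;> simp [haltedWeight, Config.haltWeight, stackHalt, FracLit.value_add]
  | succ n ih =>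
    rw [Function.iterate_succ_apply, ih]
    clear ih
    induction L with
    | nil => simp
    | cons c L ih =>
      rw [List.flatMap_cons, List.map_append, List.sum_append, ih, sum_haltWeight_stepConfig,
        List.map_cons, List.sum_cons]

/-- The probability of halting within `n` steps, as a fraction literal. -/
def haltFrac (x : Prog × List FracLit) (n : ℕ) : FracLit :=
  haltedWeight ((fun L => L.flatMap stepConfig)^[n] [([x.1], x.2, (1, 0))])

theorem value_haltFrac (x : Prog × List FracLit) (n : ℕ) :
    (haltFrac x n).value = stackHalt n [x.1] (inputOf x.2) := by
  rw [haltFrac, value_haltedWeight_iterate]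
  simp [Config.haltWeight, FracLit.value]

theorem primrec_haltFrac : Primrec₂ haltFrac := by
  refine primrec_haltedWeight.comp (Primrec.nat_iterate (h := fun _ L => L.flatMap stepConfig)
    .snd (primrec_list_singleton ?_) ?_)
  · exact .pair (primrec_list_singleton (.comp .fst .fst)) (.pair (.comp .snd .fst) (.const _))
  · exact Primrec.list_flatMap .snd (primrec_stepConfig.comp .snd)

/-! ### Membership in `Π⁰₂` -/

theorem isPi02_AST : IsPi02 AST := by
  -- The inequality `n / (n + 1) ≤ haltFrac x k`, cross-multiplied.
  refine ⟨fun x => x.2.1 * ((haltFrac x.1 x.2.2).2 + 1) ≤ (haltFrac x.1 x.2.2).1 * (x.2.1 + 1),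
    PrimrecPred.computablePred ?_, fun x => ?_⟩
  · have h : Primrec fun x : (Prog × List FracLit) × ℕ × ℕ => haltFrac x.1 x.2.2 :=
      primrec_haltFrac.comp .fst (.comp .snd .snd)
    have h' : Primrec fun x : (Prog × List FracLit) × ℕ × ℕ => x.2.1 := .comp .fst .snd
    exact Primrec.nat_le.comp (Primrec.nat_mul.comp h' (Primrec.succ.comp (.comp .snd h)))
      (Primrec.nat_mul.comp (.comp .fst h) (Primrec.succ.comp h'))
  · rw [AST, terminatesAS_iff]
    refine forall_congr' fun n => exists_congr fun k => ?_
    rw [← value_haltFrac, FracLit.value, div_le_div_iff₀ (by positivity) (by positivity)]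
    exact_mod_cast Iff.rfl

/-- Two consecutive universal quantifiers merge by pairing; as `γ` is denumerable, every number
decodes to an element of it. -/
theorem IsPi02.forall {α γ : Type} [Primcodable α] [Denumerable γ] {A : α × γ → Prop}
    (hA : IsPi02 A) : IsPi02 fun a => ∀ c, A (a, c) := by
  obtain ⟨R, hR, h⟩ := hA
  refine ⟨fun x => R ((x.1, Denumerable.ofNat γ (Nat.unpair x.2.1).1), (Nat.unpair x.2.1).2, x.2.2),
    ?_, fun a => ?_⟩
  · have hu : Primrec fun x : α × ℕ × ℕ => Nat.unpair x.2.1 :=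
      Primrec.unpair.comp (.comp .fst .snd)
    have hx : Primrec fun x : α × ℕ × ℕ =>
        ((x.1, Denumerable.ofNat γ (Nat.unpair x.2.1).1), (Nat.unpair x.2.1).2, x.2.2) :=
      .pair (.pair .fst ((Primrec.ofNat γ).comp (.comp .fst hu)))
        (.pair (.comp .snd hu) (.comp .snd .snd))
    obtain ⟨_, hR⟩ := hR
    exact ⟨fun _ => inferInstance, hR.comp hx.to_comp⟩
  · simp only [h]
    constructor
    · intro H y
      exact H _ _
    · intro H c y
      simpa using H (Nat.pair (Encodable.encode c) y)

/-! ### Dependence on finitely many variables -/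

/-- A strict upper bound on the variables in an arithmetical expression. -/
def AExp.bound : AExp → ℕ
  | .lit _ => 0
  | .var v => v + 1
  | .add e₁ e₂ | .sub e₁ e₂ | .mul e₁ e₂ => max e₁.bound e₂.bound

/-- A strict upper bound on the variables in a Boolean expression. -/
def BExp.bound : BExp → ℕ
  | .eq e₁ e₂ | .lt e₁ e₂ => max e₁.bound e₂.bound
  | .not b => b.bound
  | .and b₁ b₂ => max b₁.bound b₂.bound

/-- A strict upper bound on the variables read by a program. -/
def Prog.bound : Prog → ℕ
  | .assign _ e => e.bound
  | .seq P Q | .choice _ P Q => max P.bound Q.bound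
  | .while b P => max b.bound P.bound

theorem AExp.eval_congr {η η' : Val} {N : ℕ} (h : ∀ v < N, η v = η' v) (e : AExp)
    (he : e.bound ≤ N) : e.eval η = e.eval η' := by
  induction e <;> simp_all [bound, eval]

theorem BExp.eval_congr {η η' : Val} {N : ℕ} (h : ∀ v < N, η v = η' v) (b : BExp)
    (hb : b.bound ≤ N) : b.eval η = b.eval η' := by
  induction b with
  | eq a b | lt a b =>
    simp only [bound, max_le_iff] at hb
    rw [eval, eval, a.eval_congr h hb.1, b.eval_congr h hb.2]
  | not b ih => rw [eval, eval, ih hb]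
  | and a b iha ihb =>
    simp only [bound, max_le_iff] at hb
    rw [eval, eval, iha hb.1, ihb hb.2]

/-- Assigned variables may exceed the bound: an assignment writes the same value on both sides, so
agreement below `N` persists. -/
theorem stackHalt_congr {N : ℕ} (n : ℕ) (s : List Prog) (hs : ∀ P ∈ s, P.bound ≤ N) {η η' : Val}
    (h : ∀ v < N, η v = η' v) : stackHalt n s η = stackHalt n s η' := by
  induction n generalizing s η η' with
  | zero => cases s <;> rfl
  | succ n ih =>
    rcases s with _ | ⟨⟨v, e⟩ | ⟨P, Q⟩ | ⟨p, P, Q⟩ | ⟨b, P⟩, s⟩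
    · simp
    all_goals simp only [List.forall_mem_cons, Prog.bound, max_le_iff] at hs
    · rw [stackHalt, stackHalt, e.eval_congr h hs.1]
      refine ih s hs.2 fun w hw => ?_
      rw [Function.update_apply, Function.update_apply, h w hw]
    · rw [stackHalt, stackHalt]
      exact ih _ (by simpa [and_assoc] using hs) h
    · rw [stackHalt, stackHalt, ih (P :: s) (by simpa using ⟨hs.1.1, hs.2⟩) h,
        ih (Q :: s) (by simpa using ⟨hs.1.2, hs.2⟩) h]
    · rw [stackHalt, stackHalt, b.eval_congr h hs.1.1, ih s hs.2 h,
        ih (P :: .while b P :: s) (by simpa [Prog.bound] using ⟨hs.1.2, hs.1, hs.2⟩) h]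

/-- Only the variables below `P.bound` matter, and each of their values has a fraction literal, so
every input may be replaced by a finite list. -/
theorem UAST_iff (P : Prog) : UAST P ↔ ∀ l, AST (P, l) := by
  refine ⟨fun h l => h _, fun h η => ?_⟩
  choose lit hlit using fun v => FracLit.exists_value_eq (η v)
  have hη : ∀ v < P.bound, η v = inputOf ((List.range P.bound).map lit) v := fun v hv => by
    rw [inputOf, getD_map_range _ hv, hlit]
  have hl := h ((List.range P.bound).map lit)
  rw [AST, terminatesAS_iff] at hl
  rw [terminatesAS_iff]
  intro n
  obtain ⟨k, hk⟩ := hl n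
  exact ⟨k, by rwa [stackHalt_congr (N := P.bound) k [P] (by simp) hη]⟩

theorem isPi02_UAST : IsPi02 UAST := by
  rw [funext fun P => propext (UAST_iff P)]
  exact isPi02_AST.forall

/-! ### Deterministic executions -/

/-- `P` runs from `η` to `η'` without probabilistic branching. -/
def Exec (P : Prog) (η η' : Val) : Prop :=
  ∃ j, ∀ n s, stackHalt (n + j) (P :: s) η = stackHalt n s η'

theorem Exec.assign (η : Val) (v : Var) {e : AExp} {m : ℕ} (h : e.eval η = m) :
    Exec (.assign v e) η (Function.update η v (m : ℚ≥0)) :=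
  ⟨1, fun n s => by rw [stackHalt, h, NNRat.toNNRat_coe_nat]⟩

/-- `Exec` quantifies over all fuels and all continuations, so executions compose and their step
counts add. -/
theorem Exec.seq {P Q : Prog} {η η₁ η₂ : Val} (hP : Exec P η η₁) (hQ : Exec Q η₁ η₂) :
    Exec (.seq P Q) η η₂ := by
  obtain ⟨j, hj⟩ := hP
  obtain ⟨k, hk⟩ := hQ
  exact ⟨k + j + 1, fun n s => by rw [← add_assoc, stackHalt, ← add_assoc, hj, hk]⟩

theorem Exec.while_false {b : BExp} {η : Val} (h : b.eval η = false) (P : Prog) :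
    Exec (.while b P) η η :=
  ⟨1, fun n s => by simp [stackHalt, h]⟩

theorem Exec.while_true {b : BExp} {P : Prog} {η η₁ η₂ : Val} (h : b.eval η = true)
    (hP : Exec P η η₁) (hw : Exec (.while b P) η₁ η₂) : Exec (.while b P) η η₂ := by
  obtain ⟨j, hj⟩ := hP
  obtain ⟨k, hk⟩ := hw
  exact ⟨k + j + 1, fun n s => by rw [← add_assoc, stackHalt, if_pos h, ← add_assoc, hj, hk]⟩

theorem Exec.exists_stackHalt_eq_one {P : Prog} {η η' : Val} (h : Exec P η η') :
    ∃ n, stackHalt n [P] η = 1 := by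
  obtain ⟨j, hj⟩ := h
  exact ⟨0 + j, by rw [hj, stackHalt_nil]⟩

theorem stackHalt_le_of_exec {P : Prog} {η η' : Val} (h : Exec P η η') (n : ℕ) (s : List Prog) :
    stackHalt n (P :: s) η ≤ stackHalt n s η' := by
  obtain ⟨j, hj⟩ := h
  rw [← hj]
  exact stackHalt_mono (Nat.le_add_right _ _) _ _

/-- The invariant keeps the guard true forever; each guard test uses a unit of fuel, which drives
the induction. -/
theorem stackHalt_while_eq_zero {b : BExp} {P : Prog} {I : Val → Prop}
    (hb : ∀ η, I η → b.eval η = true) (hP : ∀ η, I η → ∃ η', Exec P η η' ∧ I η') (n : ℕ)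
    (s : List Prog) {η : Val} (hη : I η) : stackHalt n (.while b P :: s) η = 0 := by
  induction n generalizing η with
  | zero => rfl
  | succ n ih =>
    obtain ⟨η', hex, hη'⟩ := hP η hη
    rw [stackHalt, if_pos (hb η hη), ← nonpos_iff_eq_zero, ← ih hη']
    exact stackHalt_le_of_exec hex _ _

/-! ### Primitive recursive functions as programs -/

/-- `P` computes `f` from the registers `a` into the register `b`, leaving the registers below `b`
unchanged. -/
def Computes {n : ℕ} (P : Prog) (f : List.Vector ℕ n → ℕ) (a : Fin n → Var) (b : Var) : Prop :=
  ∀ (η : Val) (u : List.Vector ℕ n), (∀ i, η (a i) = u.get i) →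
    ∃ η', Exec P η η' ∧ η' b = f u ∧ ∀ v < b, η' v = η v

/-- The values go into consecutive registers from `b` on. Each program has its own output register
as lower limit of what it may change, so it cannot destroy earlier results. -/
theorem exists_computes_family {m n : ℕ} {g : Fin n → List.Vector ℕ m → ℕ} {a : Fin m → Var}
    {b : Var} (ha : ∀ i, a i < b)
    (hg : ∀ i (b : Var), (∀ i, a i < b) → ∃ P, Computes P (g i) a b) (k : ℕ) (hk : k ≤ n) :
    ∃ P, ∀ (η : Val) (u : List.Vector ℕ m), (∀ i, η (a i) = u.get i) →
      ∃ η', Exec P η η' ∧ (∀ i : Fin n, i < k → η' (b + i) = g i u) ∧ ∀ v < b, η' v = η v := by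
  induction k with
  | zero =>
    -- The grammar has no skip; a write to the scratch register `b` serves instead.
    refine ⟨.assign b (.lit (0, 0)), fun η u _ => ⟨_, Exec.assign η b (m := 0) ?_, ?_, ?_⟩⟩
    · simp [AExp.eval, FracLit.value]
    · intro i hi
      omega
    · intro v hv
      exact Function.update_of_ne hv.ne _ _
  | succ k ih =>
    obtain ⟨P, hP⟩ := ih (by omega)
    obtain ⟨Q, hQ⟩ := hg ⟨k, hk⟩ (b + k) fun i => (ha i).trans_le (Nat.le_add_right _ _)
    refine ⟨.seq P Q, fun η u hu => ?_⟩
    obtain ⟨η₁, hex₁, hval₁, hlow₁⟩ := hP η u hu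
    obtain ⟨η₂, hex₂, hval₂, hlow₂⟩ := hQ η₁ u fun i => by rw [hlow₁ _ (ha i), hu]
    refine ⟨η₂, hex₁.seq hex₂, fun i hi => ?_, fun v hv => ?_⟩
    · rcases Nat.lt_succ_iff_lt_or_eq.1 hi with hi | hi
      · rw [hlow₂ _ (Nat.add_lt_add_left hi b), hval₁ i hi]
      · obtain rfl : i = ⟨k, hk⟩ := Fin.ext hi
        exact hval₂
    · rw [hlow₂ v (Nat.lt_add_right _ hv), hlow₁ v hv]

theorem exists_computes_comp {m n : ℕ} {f : List.Vector ℕ n → ℕ}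
    {g : Fin n → List.Vector ℕ m → ℕ}
    (hf : ∀ (a : Fin n → Var) (b : Var), (∀ i, a i < b) → ∃ P, Computes P f a b)
    (hg : ∀ i (a : Fin m → Var) (b : Var), (∀ i, a i < b) → ∃ P, Computes P (g i) a b)
    (a : Fin m → Var) (b : Var) (ha : ∀ i, a i < b) :
    ∃ P, Computes P (fun u => f (List.Vector.ofFn fun i => g i u)) a b := by
  obtain ⟨P, hP⟩ := exists_computes_family ha (fun i b hb => hg i a b hb) n le_rfl
  obtain ⟨Q, hQ⟩ := hf (fun i => b + i) (b + n) fun i => Nat.add_lt_add_left i.2 b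
  -- The result appears above the arguments, in `b + n`, and is copied down to `b`.
  refine ⟨.seq P (.seq Q (.assign b (.var (b + n)))), fun η u hu => ?_⟩
  obtain ⟨η₁, hex₁, hval₁, hlow₁⟩ := hP η u hu
  obtain ⟨η₂, hex₂, hval₂, hlow₂⟩ := hQ η₁ (List.Vector.ofFn fun i => g i u) fun i => by
    rw [hval₁ i i.2, List.Vector.get_ofFn]
  refine ⟨_, hex₁.seq (hex₂.seq (Exec.assign η₂ b (m := f (List.Vector.ofFn fun i => g i u)) ?_)),
    ?_, fun v hv => ?_⟩
  · simp [AExp.eval, hval₂]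
  · simp
  · rw [Function.update_of_ne (Nat.ne_of_lt hv), hlow₂ v (Nat.lt_add_right _ hv), hlow₁ v hv]

/-- Register `b` holds the value reached so far, `b + 1` the counter, and each round computes the
next value into `b + 2` before copying it to `b`. -/
theorem exists_computes_prec {n : ℕ} {f : List.Vector ℕ n → ℕ} {g : List.Vector ℕ (n + 2) → ℕ}
    (hf : ∀ (a : Fin n → Var) (b : Var), (∀ i, a i < b) → ∃ P, Computes P f a b)
    (hg : ∀ (a : Fin (n + 2) → Var) (b : Var), (∀ i, a i < b) → ∃ P, Computes P g a b)
    (a : Fin (n + 1) → Var) (b : Var) (ha : ∀ i, a i < b) :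
    ∃ P, Computes P (fun u : List.Vector ℕ (n + 1) =>
      u.head.rec (f u.tail) fun y IH => g (y ::ᵥ IH ::ᵥ u.tail)) a b := by
  obtain ⟨P, hP⟩ := hf (fun i => a i.succ) b fun i => ha _
  obtain ⟨Q, hQ⟩ := hg (Fin.cons (b + 1) (Fin.cons b fun i => a i.succ)) (b + 2) fun i => by
    refine Fin.cases ?_ (fun i => Fin.cases ?_ (fun i => ?_) i) i
    · simp
    · simp
    · simpa using (ha i.succ).trans_le (Nat.le_add_right b 2)
  let body : Prog := .seq Q (.seq (.assign b (.var (b + 2)))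
    (.assign (b + 1) (.add (.var (b + 1)) (.lit (1, 0)))))
  let loop : Prog := .while (.lt (.var (b + 1)) (.var (a 0))) body
  refine ⟨.seq P (.seq (.assign (b + 1) (.lit (0, 0))) loop), fun η u hu => ?_⟩
  let r : ℕ → ℕ := fun y => y.rec (f u.tail) fun y IH => g (y ::ᵥ IH ::ᵥ u.tail)
  have hhead : η (a 0) = u.head := by rw [hu, List.Vector.get_zero]
  have htail (i : Fin n) : η (a i.succ) = u.tail.get i := by
    rw [hu, List.Vector.get_tail_succ]
  -- Loop invariant, by induction on the number `d` of rounds left. The bound in `a 0` lies below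
  -- `b` and is never overwritten.
  have hloop (d : ℕ) : ∀ (y : ℕ) (ζ : Val), y + d = u.head → ζ (b + 1) = y →
      ζ b = Nat.cast (r y) → (∀ v < b, ζ v = η v) → ∃ ζ' : Val, Exec loop ζ ζ' ∧ ζ' b = Nat.cast (r u.head) ∧
        ∀ v < b, ζ' v = η v := by
    induction d with
    | zero =>
      intro y ζ hy h1 h0 hlow
      obtain rfl : y = u.head := hy
      refine ⟨ζ, Exec.while_false ?_ _, h0, hlow⟩
      simp [BExp.eval, AExp.eval, h1, hlow _ (ha 0), hhead]
    | succ d ih =>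
      intro y ζ hy h1 h0 hlow
      obtain ⟨ζ₁, hex, hval, hlow₁⟩ := hQ ζ (y ::ᵥ r y ::ᵥ u.tail) fun i => by
        refine Fin.cases ?_ (fun i => Fin.cases ?_ (fun i => ?_) i) i
        · simpa using h1
        · exact h0
        · simpa using (hlow _ (ha i.succ)).trans (htail i)
      have hex₂ := Exec.assign ζ₁ b (e := .var (b + 2)) (m := r (y + 1)) (by
        simp [AExp.eval, hval, r])
      have hex₃ := Exec.assign (Function.update ζ₁ b (r (y + 1) : ℚ≥0)) (b + 1)
        (e := .add (.var (b + 1)) (.lit (1, 0))) (m := y + 1) (by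
          simp [AExp.eval, FracLit.value, hlow₁ (b + 1) (Nat.lt_succ_self _), h1])
      obtain ⟨ζ', hex', hval', hlow'⟩ := ih (y + 1) _ (by omega)
        (Function.update_self (b + 1) ((y + 1 : ℕ) : ℚ≥0) (Function.update ζ₁ b (r (y + 1) : ℚ≥0)))
        (by simp) (fun v hv => by
          rw [Function.update_of_ne (Nat.ne_of_lt (Nat.lt_succ_of_lt hv)),
            Function.update_of_ne (Nat.ne_of_lt hv), hlow₁ v (Nat.lt_add_right 2 hv), hlow v hv])
      refine ⟨ζ', Exec.while_true ?_ (hex.seq (hex₂.seq hex₃)) hex', hval', hlow'⟩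
      have : y < u.head := by omega
      simpa [BExp.eval, AExp.eval, h1, hlow _ (ha 0), hhead] using this
  obtain ⟨η₁, hex₁, hval₁, hlow₁⟩ := hP η u.tail htail
  have hex₂ := Exec.assign η₁ (b + 1) (e := .lit (0, 0)) (m := 0) (by
    simp [AExp.eval, FracLit.value])
  obtain ⟨η₃, hex₃, hval₃, hlow₃⟩ := hloop u.head 0 _ (by omega)
    (Function.update_self (b + 1) ((0 : ℕ) : ℚ≥0) η₁) (by
      rw [Function.update_of_ne (Nat.ne_of_lt (Nat.lt_succ_self b))]
      exact hval₁) (fun v hv => by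
      rw [Function.update_of_ne (Nat.ne_of_lt (Nat.lt_succ_of_lt hv)), hlow₁ v hv])
  exact ⟨η₃, hex₁.seq (hex₂.seq hex₃), hval₃, hlow₃⟩

theorem exists_computes {n : ℕ} {f : List.Vector ℕ n → ℕ} (hf : Nat.Primrec' f)
    (a : Fin n → Var) (b : Var) (ha : ∀ i, a i < b) : ∃ P, Computes P f a b := by
  induction hf generalizing b with
  | zero =>
    refine ⟨.assign b (.lit (0, 0)), fun η u _ => ⟨_, Exec.assign η b (m := 0) ?_, ?_, ?_⟩⟩
    · simp [AExp.eval, FracLit.value]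
    · simp
    · exact fun v hv => Function.update_of_ne (Nat.ne_of_lt hv) _ _
  | succ =>
    refine ⟨.assign b (.add (.var (a 0)) (.lit (1, 0))), fun η u hu =>
      ⟨_, Exec.assign η b (m := u.head + 1) ?_, ?_, ?_⟩⟩
    · simp [AExp.eval, FracLit.value, hu]
    · simp
    · exact fun v hv => Function.update_of_ne (Nat.ne_of_lt hv) _ _
  | get i =>
    refine ⟨.assign b (.var (a i)), fun η u hu => ⟨_, Exec.assign η b (m := u.get i) ?_, ?_, ?_⟩⟩
    · simp [AExp.eval, hu]
    · simp
    · exact fun v hv => Function.update_of_ne (Nat.ne_of_lt hv) _ _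
  | comp g _ _ hf hg => exact exists_computes_comp hf hg a b ha
  | prec _ _ hf hg => exact exists_computes_prec hf hg a b ha

/-! ### Unbounded search -/

/-- The registers `0`, `1`, `2` hold `y`, `x`, `k`. -/
def Holds (y x k : ℕ) (η : Val) : Prop := η 0 = y ∧ η 1 = x ∧ η 2 = k

/-- The loop that increments register `2` until the program `Q` puts `0` into register `3`. -/
def searchLoop (Q : Prog) : Prog :=
  .while (.lt (.lit (0, 0)) (.var 3)) (.seq Q (.assign 2 (.add (.var 2) (.lit (1, 0)))))

/-- Search for the least value of register `2` for which `Q` puts `0` into register `3`. -/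
def search (Q : Prog) : Prog := .seq (.assign 3 (.lit (1, 0))) (searchLoop Q)

/-- The registers `0`, `1`, `2`. -/
def inputRegs : Fin 3 → Var := fun i => i

theorem exec_search_body {Q : Prog} {G : List.Vector ℕ 3 → ℕ}
    (hQ : Computes Q G inputRegs 3) {y x k : ℕ} {η : Val} (h : Holds y x k η) :
    ∃ η', Exec (.seq Q (.assign 2 (.add (.var 2) (.lit (1, 0))))) η η' ∧ Holds y x (k + 1) η' ∧
      η' 3 = G (y ::ᵥ x ::ᵥ k ::ᵥ .nil) := by
  obtain ⟨h0, h1, h2⟩ := h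
  obtain ⟨η₁, hex, hval, hlow⟩ := hQ η (y ::ᵥ x ::ᵥ k ::ᵥ .nil) fun i => by
    fin_cases i
    · exact h0
    · exact h1
    · exact h2
  refine ⟨_, hex.seq (Exec.assign η₁ 2 (m := k + 1) ?_), ⟨?_, ?_, ?_⟩, ?_⟩
  · simp [AExp.eval, FracLit.value, hlow, h2]
  · simp [hlow, h0]
  · simp [hlow, h1]
  · simp
  · simp [hval]

/-- The witness `k + d` need not be the least one: the induction is on the distance to it, and a
guard that fails earlier ends the loop anyway. -/
theorem exists_exec_searchLoop {Q : Prog} {G : List.Vector ℕ 3 → ℕ}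
    (hQ : Computes Q G inputRegs 3) {y x : ℕ} (d : ℕ) : ∀ (k : ℕ) (η : Val), Holds y x k η →
    G (y ::ᵥ x ::ᵥ (k + d) ::ᵥ .nil) = 0 → ∃ η', Exec (searchLoop Q) η η' := by
  induction d with
  | zero =>
    intro k η h hG
    obtain ⟨η₁, hex, -, h3⟩ := exec_search_body hQ h
    by_cases hη : 0 < η 3
    · refine ⟨η₁, Exec.while_true (by simpa [BExp.eval, AExp.eval, FracLit.value] using hη) hex
        (Exec.while_false ?_ _)⟩
      rw [add_zero] at hG
      simp [BExp.eval, AExp.eval, FracLit.value, h3, hG]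
    · exact ⟨η, Exec.while_false
        (by simpa [BExp.eval, AExp.eval, FracLit.value] using hη) _⟩
  | succ d ih =>
    intro k η h hG
    obtain ⟨η₁, hex, h₁, -⟩ := exec_search_body hQ h
    by_cases hη : 0 < η 3
    · obtain ⟨η', hex'⟩ := ih (k + 1) η₁ h₁ (by rwa [add_assoc, add_comm 1])
      exact ⟨η', Exec.while_true (by simpa [BExp.eval, AExp.eval, FracLit.value] using hη) hex hex'⟩
    · exact ⟨η, Exec.while_false
        (by simpa [BExp.eval, AExp.eval, FracLit.value] using hη) _⟩

theorem exists_stackHalt_search_eq_one {Q : Prog} {G : List.Vector ℕ 3 → ℕ}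
    (hQ : Computes Q G inputRegs 3) {y x : ℕ} (hG : ∃ k, G (y ::ᵥ x ::ᵥ k ::ᵥ .nil) = 0)
    {η : Val} (h : Holds y x 0 η) : ∃ n, stackHalt n [search Q] η = 1 := by
  obtain ⟨k, hk⟩ := hG
  obtain ⟨h0, h1, h2⟩ := h
  obtain ⟨η', hex⟩ := exists_exec_searchLoop hQ (y := y) (x := x) k 0
    (Function.update η 3 ((1 : ℕ) : ℚ≥0))
    ⟨by simp [h0], by simp [h1], by simp [h2]⟩ (by rwa [zero_add])
  exact ((Exec.assign η 3 (by simp [AExp.eval, FracLit.value])).seq hex).exists_stackHalt_eq_one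

theorem stackHalt_search_eq_zero {Q : Prog} {G : List.Vector ℕ 3 → ℕ}
    (hQ : Computes Q G inputRegs 3) {y x : ℕ} (hG : ∀ k, G (y ::ᵥ x ::ᵥ k ::ᵥ .nil) ≠ 0)
    {η : Val} (h : Holds y x 0 η) (n : ℕ) : stackHalt n [search Q] η = 0 := by
  obtain ⟨h0, h1, h2⟩ := h
  rw [← nonpos_iff_eq_zero]
  -- The extra unit of fuel allows `search` to be unfolded even for `n = 0`.
  refine (stackHalt_le_succ _ _ _).trans ?_
  rw [search, stackHalt]
  refine (stackHalt_le_of_exec (Exec.assign η 3 (m := 1)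
    (by simp [AExp.eval, FracLit.value])) _ _).trans_eq ?_
  refine stackHalt_while_eq_zero (I := fun η => (∃ k, Holds y x k η) ∧ 0 < η 3) ?_ ?_ n [] ?_
  · intro η hη
    simpa [BExp.eval, AExp.eval, FracLit.value] using hη.2
  · rintro η ⟨⟨k, hk⟩, -⟩
    obtain ⟨η', hex, hk', h3⟩ := exec_search_body hQ hk
    refine ⟨η', hex, ⟨_, hk'⟩, ?_⟩
    rw [h3, Nat.cast_pos]
    exact Nat.pos_of_ne_zero (hG k)
  · exact ⟨⟨0, by simp [h0], by simp [h1], by simp [h2]⟩, by simp⟩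

/-! ### Random choice of a natural number -/

/-- The odds of a fair coin. -/
def fairCoin : ProbLit := ⟨1, 1, by norm_num⟩

theorem value_fairCoin : fairCoin.value = 1 / 2 := by
  norm_num [fairCoin, ProbLit.value]

/-- Toss a fair coin until register `2` is cleared, counting in register `0`. -/
def geometricLoop : Prog :=
  .while (.eq (.var 2) (.lit (1, 0))) (.choice fairCoin (.assign 2 (.lit (0, 0)))
    (.assign 0 (.add (.var 0) (.lit (1, 0)))))

/-- The left branch takes four steps (guard, toss, assignment, failed guard); the right branch takes
three and is back at the loop with `n + 1` left. -/
theorem stackHalt_geometricLoop {y x : ℕ} {η : Val} (h : Holds y x 1 η) :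
    ∃ η₀ η₁, Holds y x 0 η₀ ∧ Holds (y + 1) x 1 η₁ ∧ ∀ n s,
      stackHalt (n + 4) (geometricLoop :: s) η =
        1 / 2 * stackHalt n s η₀ + 1 / 2 * stackHalt (n + 1) (geometricLoop :: s) η₁ := by
  obtain ⟨h0, h1, h2⟩ := h
  refine ⟨Function.update η 2 ((0 : ℕ) : ℚ≥0), Function.update η 0 ((y + 1 : ℕ) : ℚ≥0),
    ⟨by simp [h0], by simp [h1], by simp⟩, ⟨by simp, by simp [h1], by simp [h2]⟩, fun n s => ?_⟩
  have hb : BExp.eval η (.eq (.var 2) (.lit (1, 0))) = true := by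
    simp [BExp.eval, AExp.eval, FracLit.value, h2]
  have hb' : BExp.eval (Function.update η 2 ((0 : ℕ) : ℚ≥0)) (.eq (.var 2) (.lit (1, 0))) =
      false := by
    simp [BExp.eval, AExp.eval, FracLit.value]
  have he : AExp.eval η (.add (.var 0) (.lit (1, 0))) = ((y + 1 : ℕ) : ℚ) := by
    simp [AExp.eval, FracLit.value, h0]
  have he' : AExp.eval η (.lit (0, 0)) = ((0 : ℕ) : ℚ) := by
    simp [AExp.eval, FracLit.value]
  have hfair : 1 - (1 / 2 : ℚ≥0) = 1 / 2 := tsub_eq_of_eq_add (by norm_num)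
  rw [geometricLoop, stackHalt, if_pos hb, stackHalt, stackHalt, stackHalt, he, he',
    NNRat.toNNRat_coe_nat, NNRat.toNNRat_coe_nat, value_fairCoin, hfair]
  congr 2
  rw [stackHalt, if_neg (by rw [hb']; decide)]

/-- After `j` tosses only mass `2 ^ (-j)` is still in the loop; all other branches halt with
probability one. The sum form avoids truncated subtraction in `ℚ≥0`. -/
theorem exists_one_le_stackHalt_geometricLoop {x : ℕ} {s : List Prog}
    (hs : ∀ y η, Holds y x 0 η → ∃ n, stackHalt n s η = 1) (j : ℕ) : ∀ (y : ℕ) (η : Val),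
      Holds y x 1 η → ∃ n, 1 ≤ stackHalt n (geometricLoop :: s) η + (1 / 2) ^ j := by
  induction j with
  | zero => exact fun y η _ => ⟨0, by simp⟩
  | succ j ih =>
    intro y η h
    obtain ⟨η₀, η₁, h₀, h₁, hstep⟩ := stackHalt_geometricLoop h
    obtain ⟨m, hm⟩ := hs y η₀ h₀
    obtain ⟨n, hn⟩ := ih (y + 1) η₁ h₁
    refine ⟨max m n + 4, ?_⟩
    have hm' : 1 ≤ stackHalt (max m n) s η₀ :=
      hm.ge.trans (stackHalt_mono (le_max_left _ _) _ _)
    have hn' : 1 ≤ stackHalt (max m n + 1) (geometricLoop :: s) η₁ + (1 / 2) ^ j :=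
      hn.trans (by gcongr; exact stackHalt_mono ((le_max_right _ _).trans (Nat.le_succ _)) _ _)
    rw [hstep, pow_succ]
    calc (1 : ℚ≥0) = 1 / 2 * 1 + 1 / 2 * 1 := by norm_num
      _ ≤ 1 / 2 * stackHalt (max m n) s η₀ +
          1 / 2 * (stackHalt (max m n + 1) (geometricLoop :: s) η₁ + (1 / 2) ^ j) := by gcongr
      _ = _ := by ring

/-- From counter `y₀ - d` the loop stops at `y₀` with probability `2 ^ (-(d + 1))`, and this mass
never halts. -/
theorem stackHalt_geometricLoop_le {y₀ x : ℕ} {s : List Prog}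
    (hs : ∀ η, Holds y₀ x 0 η → ∀ n, stackHalt n s η = 0) (d : ℕ) : ∀ (y : ℕ) (η : Val),
      y + d = y₀ → Holds y x 1 η →
        ∀ n, stackHalt n (geometricLoop :: s) η + (1 / 2) ^ (d + 1) ≤ 1 := by
  induction d with
  | zero =>
    rintro y η rfl h n
    obtain ⟨η₀, η₁, h₀, -, hstep⟩ := stackHalt_geometricLoop h
    -- By monotonicity four more steps may be granted, so a full round is available for every `n`.
    calc stackHalt n (geometricLoop :: s) η + (1 / 2) ^ (0 + 1)
        ≤ stackHalt (n + 4) (geometricLoop :: s) η + (1 / 2) ^ (0 + 1) := by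
          gcongr
          exact stackHalt_mono (Nat.le_add_right _ _) _ _
      _ ≤ 1 / 2 * 0 + 1 / 2 * 1 + (1 / 2) ^ (0 + 1) := by
          rw [hstep, hs η₀ h₀ n]
          gcongr
          exact stackHalt_le_one _ _ _
      _ = 1 := by norm_num
  | succ d ih =>
    intro y η hy h n
    obtain ⟨η₀, η₁, -, h₁, hstep⟩ := stackHalt_geometricLoop h
    calc stackHalt n (geometricLoop :: s) η + (1 / 2) ^ (d + 1 + 1)
        ≤ stackHalt (n + 4) (geometricLoop :: s) η + (1 / 2) ^ (d + 1 + 1) := by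
          gcongr
          exact stackHalt_mono (Nat.le_add_right _ _) _ _
      _ = 1 / 2 * stackHalt n s η₀ + 1 / 2 *
          (stackHalt (n + 1) (geometricLoop :: s) η₁ + (1 / 2) ^ (d + 1)) := by
          rw [hstep]
          ring
      _ ≤ 1 / 2 * 1 + 1 / 2 * 1 := by
          gcongr
          · exact stackHalt_le_one _ _ _
          · exact ih (y + 1) η₁ (by omega) h₁ _
      _ = 1 := by norm_num

theorem nat_div_succ_add (n : ℕ) : (n : ℚ≥0) / (n + 1) + 1 / (n + 1) = 1 := by
  rw [← add_div, div_self (by positivity)]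

theorem terminatesAS_of_one_le {P : Prog} {η : Val}
    (h : ∀ j : ℕ, ∃ n, 1 ≤ stackHalt n [P] η + (1 / 2) ^ j) : TerminatesAS P η := by
  rw [terminatesAS_iff]
  intro n
  obtain ⟨k, hk⟩ := h n
  refine ⟨k, ?_⟩
  have hn : (1 / 2 : ℚ≥0) ^ n ≤ 1 / (n + 1) := by
    rw [one_div_pow]
    refine one_div_le_one_div_of_le (by positivity) ?_
    exact_mod_cast Nat.lt_two_pow_self
  exact le_of_add_le_add_right ((nat_div_succ_add n).le.trans (hk.trans (by gcongr)))

theorem not_terminatesAS_of_le {P : Prog} {η : Val} {j : ℕ}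
    (h : ∀ n, stackHalt n [P] η + (1 / 2) ^ j ≤ 1) : ¬ TerminatesAS P η := by
  rw [terminatesAS_iff]
  intro H
  -- With `n = 2 ^ j` the permitted deficit `1 / (n + 1)` is smaller than the lost mass `2 ^ (-j)`.
  obtain ⟨k, hk⟩ := H (2 ^ j)
  have hj : (1 : ℚ≥0) / ((2 ^ j : ℕ) + 1) < (1 / 2) ^ j := by
    rw [one_div_pow]
    refine one_div_lt_one_div_of_lt (by positivity) ?_
    push_cast
    exact lt_add_one _
  exact absurd (h k) (not_le.2 ((nat_div_succ_add (2 ^ j)).symm.trans_lt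
    (add_lt_add_of_le_of_lt hk hj)))

/-! ### Hardness -/

/-- Put a random number into register `0`, then search. -/
def guessAndSearch (Q : Prog) : Prog :=
  .seq (.assign 0 (.lit (0, 0))) (.seq (.assign 2 (.lit (1, 0))) (.seq geometricLoop (search Q)))

/-- Put `x` into register `1` and a random number into register `0`, then search. -/
def reductionProg (Q : Prog) (x : ℕ) : Prog :=
  .seq (.assign 1 (.lit (x, 0))) (guessAndSearch Q)

/-- Four sequencing steps and three assignments make `7`. Registers `0`, `1`, `2` are all
overwritten, which removes the dependence on the input. -/
theorem stackHalt_reductionProg (Q : Prog) (x : ℕ) (η : Val) : ∃ η₁, Holds 0 x 1 η₁ ∧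
    ∀ n, stackHalt (n + 7) [reductionProg Q x] η = stackHalt n [geometricLoop, search Q] η₁ := by
  have hl (η : Val) (m : ℕ) : (AExp.eval η (.lit (m, 0))).toNNRat = m := by
    simp [AExp.eval, FracLit.value]
  refine ⟨Function.update (Function.update (Function.update η 1 (x : ℚ≥0)) 0 ((0 : ℕ) : ℚ≥0)) 2
    ((1 : ℕ) : ℚ≥0), ⟨by simp, by simp, by simp⟩, fun n => ?_⟩
  rw [reductionProg, guessAndSearch, stackHalt, stackHalt, stackHalt, stackHalt, stackHalt,
    stackHalt, stackHalt, hl, hl, hl]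

theorem terminatesAS_reductionProg_iff {Q : Prog} {G : List.Vector ℕ 3 → ℕ}
    (hQ : Computes Q G inputRegs 3) (x : ℕ) (η : Val) :
    TerminatesAS (reductionProg Q x) η ↔ ∀ y, ∃ k, G (y ::ᵥ x ::ᵥ k ::ᵥ .nil) = 0 := by
  obtain ⟨η₁, hη₁, hstart⟩ := stackHalt_reductionProg Q x η
  refine ⟨fun h => ?_, fun h => ?_⟩
  · by_contra! hy
    obtain ⟨y, hy⟩ := hy
    refine not_terminatesAS_of_le (j := y + 1) (fun n => ?_) h
    calc stackHalt n [reductionProg Q x] η + (1 / 2) ^ (y + 1)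
        ≤ stackHalt (n + 7) [reductionProg Q x] η + (1 / 2) ^ (y + 1) := by
          gcongr
          exact stackHalt_mono (Nat.le_add_right _ _) _ _
      _ ≤ 1 := by
          rw [hstart]
          exact stackHalt_geometricLoop_le (y₀ := y)
            (fun η hη => stackHalt_search_eq_zero hQ hy hη) y 0 η₁ (zero_add y) hη₁ n
  · refine terminatesAS_of_one_le fun j => ?_
    obtain ⟨n, hn⟩ := exists_one_le_stackHalt_geometricLoop
      (fun y η hη => exists_stackHalt_search_eq_one hQ (h y) hη) j 0 η₁ hη₁
    exact ⟨n + 7, by rwa [hstart]⟩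

/-- On the level of codes `x` occurs only inside one literal; the code of `guessAndSearch Q` is a
constant. -/
theorem primrec_reductionProg (Q : Prog) : Primrec (reductionProg Q) := by
  refine Primrec.encode_iff.1 ?_
  change Primrec fun x => 4 * Nat.pair (4 * Nat.pair 1 (5 * Nat.pair x 0)) (guessAndSearch Q).code + 1
  exact Primrec.succ.comp (Primrec.nat_mul.comp (.const 4) (Primrec₂.natPair.comp
    (Primrec.nat_mul.comp (.const 4) (Primrec₂.natPair.comp (.const 1)
      (Primrec.nat_mul.comp (.const 5) (Primrec₂.natPair.comp .id (.const 0))))) (.const _)))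

open Nat.Partrec (Code) in
-- Kleene's normal form: a decider of `R` is replaced by its step-bounded evaluation, and `k` packs
-- the witness together with the step bound.
theorem IsPi02.exists_primrec {β : Type} [Primcodable β] {C : β → Prop} (hC : IsPi02 C) :
    ∃ G : List.Vector ℕ 3 → ℕ, Nat.Primrec' G ∧
      ∀ x, C x ↔ ∀ y, ∃ k, G (y ::ᵥ Encodable.encode x ::ᵥ k ::ᵥ .nil) = 0 := by
  obtain ⟨R, ⟨_, hR⟩, h⟩ := hC
  obtain ⟨c, hc⟩ := Code.exists_code.1 hR
  have hcR (x : β) (y z : ℕ) : R (x, y, z) ↔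
      ∃ j, Code.evaln j c (Nat.pair (Encodable.encode x) (Nat.pair y z)) = some 1 := by
    have heval : c.eval (Nat.pair (Encodable.encode x) (Nat.pair y z)) =
        Part.some (Encodable.encode (decide (R (x, y, z)))) := by
      rw [hc]
      change Part.bind (Part.ofOption
        (Encodable.decode (Encodable.encode (x, y, z)) : Option (β × ℕ × ℕ))) _ = _
      rw [Encodable.encodek]
      simp
    -- The value `1` is the code of `true`.
    have : R (x, y, z) ↔ 1 ∈ c.eval (Nat.pair (Encodable.encode x) (Nat.pair y z)) := by
      rw [heval, Part.mem_some_iff]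
      by_cases hxyz : R (x, y, z) <;> simp [hxyz]
    rw [this, Code.evaln_complete]
    rfl
  let G : List.Vector ℕ 3 → ℕ := fun v =>
    if Code.evaln (Nat.unpair (v.get 2)).2 c
      (Nat.pair (v.get 1) (Nat.pair (v.get 0) (Nat.unpair (v.get 2)).1)) = some 1 then 0 else 1
  refine ⟨G, Nat.Primrec'.of_prim ?_, fun x => ?_⟩
  · have hget (i : Fin 3) : Primrec fun v : List.Vector ℕ 3 => v.get i :=
      Primrec.vector_get.comp .id (.const i)
    have hu := Primrec.unpair.comp (hget 2)
    exact .ite (Primrec.eq.comp (Code.primrec_evaln.comp (.pair (.pair (.comp .snd hu) (.const c))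
      (Primrec₂.natPair.comp (hget 1) (Primrec₂.natPair.comp (hget 0) (.comp .fst hu)))))
      (.const (some 1))) (.const 0) (.const 1)
  · rw [h]
    refine forall_congr' fun y => ?_
    have hG (k : ℕ) : G (y ::ᵥ Encodable.encode x ::ᵥ k ::ᵥ .nil) = 0 ↔
        Code.evaln (Nat.unpair k).2 c
          (Nat.pair (Encodable.encode x) (Nat.pair y (Nat.unpair k).1)) = some 1 := by
      change (if Code.evaln (Nat.unpair k).2 c
        (Nat.pair (Encodable.encode x) (Nat.pair y (Nat.unpair k).1)) = some 1 then 0 else 1) = 0 ↔ _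
      simp
    simp only [hcR, hG]
    constructor
    · rintro ⟨z, j, hj⟩
      exact ⟨Nat.pair z j, by simpa using hj⟩
    · rintro ⟨k, hk⟩
      exact ⟨_, _, hk⟩

theorem IsPi02.exists_reduction {β : Type} [Primcodable β] {C : β → Prop} (hC : IsPi02 C) :
    ∃ f : β → Prog, Computable f ∧ ∀ x η, C x ↔ TerminatesAS (f x) η := by
  obtain ⟨G, hG, h⟩ := hC.exists_primrec
  obtain ⟨Q, hQ⟩ := exists_computes hG inputRegs 3 fun i => i.2
  refine ⟨fun x => reductionProg Q (Encodable.encode x),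
    ((primrec_reductionProg Q).comp .encode).to_comp, fun x η => ?_⟩
  rw [h, terminatesAS_reductionProg_iff hQ]

theorem IsPi02.manyOneReducible_UAST {β : Type} [Primcodable β] {C : β → Prop} (hC : IsPi02 C) :
    ManyOneReducible C UAST := by
  obtain ⟨f, hf, h⟩ := hC.exists_reduction
  exact ⟨f, hf, fun x => ⟨fun hx η => (h x η).1 hx, fun hx => (h x 0).2 (hx 0)⟩⟩

theorem IsPi02.manyOneReducible_AST {β : Type} [Primcodable β] {C : β → Prop} (hC : IsPi02 C) :
    ManyOneReducible C AST := by
  obtain ⟨f, hf, h⟩ := hC.exists_reduction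
  -- Since termination of `f x` does not depend on the input, any fixed list will do.
  exact ⟨fun x => (f x, []), hf.pair (.const []), fun x => h x _⟩

end PGCL

theorem mainTheorem2 :
    PGCL.IsPi02Complete PGCL.UAST ∧ ManyOneEquiv PGCL.UAST PGCL.AST :=
  ⟨⟨PGCL.isPi02_UAST, fun _ _ _ hC => hC.manyOneReducible_UAST⟩,
    PGCL.isPi02_UAST.manyOneReducible_AST, PGCL.isPi02_AST.manyOneReducible_UAST⟩
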